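/- For a real $m\times n$ matrix $A$ let $\gamma_2(A)=\min\{\|B\|_{2\to\infty}\|C\|_{1\to2} : A=BC\}$, where $C:\ell_1^n\to\ell_2^k$ and $B:\ell_2^k\to\ell_\infty^m$ range over linear operators ($k$ arbitrary) and $\|\cdot\|_{p\to q}$ is the $\ell_p\to\ell_q$ operator norm. For a set system $\mathcal F$ on a finite set $V$ let $\gamma_2(\mathcal F)$ be the $\gamma_2$ norm of its incidence matrix (rows indexed by the members of $\mathcal F$, columns by the points of $V$); let $\operatorname{disc}\mathcal F=\min_{\chi:V\to\{-1,1\}}\max_{F\in\mathcal F}\bigl|\sum_{v\in F}\chi(v)\bigr|$ and $\operatorname{herdisc}\mathcal F=\max_{J\subseteq V}\operatorname{disc}\{F\cap J:F\in\mathcal F\}$, where $\{F\cap J:F\in\mathcal F\}$ is a set system on $J$. For $n\ge1$ let $\mathcal{AP}=\mathcal{AP}_n$ be the system of all nonempty arithmetic progressions $\{a,a+\delta,\dots,a+(\ell-1)\delta\}$ ($\delta,\ell\ge1$) contained in $[n]=\{1,\dots,n\}$, and for $d\ge1$ let $\mathcal{AP}_n^d=\{P_1\times\cdots\times P_d : P_1,\dots,P_d\in\mathcal{AP}_n\}$,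 a set system on $[n]^d$. 1. There are absolute constants $c,C>0$ such that $c\,n^{1/4}\le\gamma_2(\mathcal{AP}_n)\le C\,n^{1/4}$ for all $n\ge1$; that is, $\gamma_2(\mathcal{AP}_n)=\Theta(n^{1/4})$. 2. There is an absolute constant $C>0$ such that $\operatorname{herdisc}\mathcal{AP}_n\le C\,n^{1/4}\sqrt{\log n}$ for all $n\ge2$. 3. For every $d\ge1$ there are constants $c,C>0$ depending only on $d$ such that $c\,n^{d/4}\le\gamma_2(\mathcal{AP}_n^d)\le C\,n^{d/4}$ for all $n\ge1$; that is, $\gamma_2(\mathcal{AP}_n^d)=\Theta(n^{d/4})$ for fixed $d$. -/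

import Mathlib

open scoped Matrix

noncomputable section

namespace DiscAP

/-- The factorization norm `γ₂(A) = min {‖B‖_{2→∞} ‖C‖_{1→2} : A = B C}` of a real matrix `A`.
Here `C : ℓ₁ⁿ → ℓ₂ᵏ` and `B : ℓ₂ᵏ → ℓ_∞ᵐ` are linear operators with `k` arbitrary, `‖B‖` and `‖C‖`
are their operator norms, and the sup norm is the norm of `m → ℝ`. -/
def gamma2 {m n : Type*} [Fintype m] [Fintype n] (A : Matrix m n ℝ) : ℝ :=
  sInf {t : ℝ | ∃ (k : ℕ) (B : EuclideanSpace ℝ (Fin k) →L[ℝ] (m → ℝ))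
    (C : PiLp 1 (fun _ : n => ℝ) →L[ℝ] EuclideanSpace ℝ (Fin k)),
    (∀ x, B (C x) = A *ᵥ WithLp.ofLp x) ∧ t = ‖B‖ * ‖C‖}

/-- The incidence matrix of a set system `F` on the ground set `V`: rows are indexed by the members
of `F`, columns by the points of `V`. -/
def incidence {V : Type*} [DecidableEq V] (F : Finset (Finset V)) : Matrix F V ℝ :=
  fun S v => if v ∈ S.1 then 1 else 0

/-- The `γ₂` norm of a set system is that of its incidence matrix. -/
def gamma2System {V : Type*} [Fintype V] [DecidableEq V] (F : Finset (Finset V)) : ℝ :=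
  gamma2 (incidence F)

/-- The discrepancy of a set system: the minimum over all colorings `χ : V → {-1, 1}` of the maximum
of `|∑_{v ∈ S} χ(v)|` over `S ∈ F` (the maximum over an empty family is `0`). -/
def disc {V : Type*} [Fintype V] [DecidableEq V] (F : Finset (Finset V)) : ℕ :=
  (Finset.univ : Finset (V → ℤˣ)).inf' ⟨fun _ => 1, Finset.mem_univ _⟩
    fun χ => F.sup fun S => (∑ v ∈ S, (χ v : ℤ)).natAbs

/-- The restriction `{S ∩ J : S ∈ F}` of a set system to the ground set `J`. -/
def restrict {V : Type*} [DecidableEq V] (F : Finset (Finset V)) (J : Finset V) :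
    Finset (Finset J) :=
  F.image fun S => S.subtype (· ∈ J)

/-- The hereditary discrepancy: the maximum discrepancy of a restriction. -/
def herdisc {V : Type*} [Fintype V] [DecidableEq V] (F : Finset (Finset V)) : ℕ :=
  (Finset.univ : Finset (Finset V)).sup fun J => disc (restrict F J)

/-- The `d`-fold product `{S₁ × ⋯ × S_d : S₁, …, S_d ∈ F}`, a set system on `V ^ d`. -/
def power {V : Type*} [DecidableEq V] (F : Finset (Finset V)) (d : ℕ) :
    Finset (Finset (Fin d → V)) :=
  (Fintype.piFinset fun _ : Fin d => F).image fun S => Fintype.piFinset S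

open Classical in
/-- The system of all (nonempty) arithmetic progressions `{a, a + δ, …, a + (l - 1) δ}`, with
`δ ≥ 1` and `l ≥ 1`, that are contained in `[n] = {1, …, n}`. -/
def AP (n : ℕ) : Finset (Finset (Finset.Icc 1 n)) :=
  Finset.univ.filter fun S => ∃ a δ l : ℕ, 1 ≤ δ ∧ 1 ≤ l ∧
    Subtype.val '' (S : Set (Finset.Icc 1 n)) = {x : ℕ | ∃ i < l, x = a + i * δ}

end DiscAP

end

open scoped Matrix

/-! Bounding `gamma2` amounts to writing the matrix entries as inner products of short vectors. Both
such factorizations and lower bounds `μ ‖f‖² ≤ ‖A f‖²` are stable under tensor powers, so the case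
of dimension `d` follows from estimates in dimension one.

Upper bound: a progression is a difference of two initial segments of a residue class. With `s`
about `√n`, such a segment splits into fewer than `s` single points and at most one dyadic block of
length `s * 2 ^ k` for each `k`. Geometric weights on the blocks give progressions squared norm
`O(√n)` and points squared norm `O(1)` (`hasFactorization_AP`).

Lower bound (Roth's argument): by Dirichlet's theorem each frequency admits a difference `δ ≤ √n`
along which progressions of length `L` about `√n / 13` hardly cancel. By Parseval, `O(n ^ (3 / 2))`
clipped progressions form a matrix with `‖A f‖² ≥ (L² / 4) ‖f‖²` (`exists_AP_rows`), and the trace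
inequality `HasFactorization.card_le` turns this into `(β κ)² ≥ c √n`.

Hereditary discrepancy: restricting to `J` only selects some of the column vectors. A subgaussian
signing of these, tested against all row vectors and their negatives, has discrepancy `O(β κ √log
|F|)`, and `|F|` is polynomial in `n`. The signing comes from a derandomized Gram-Schmidt walk
(`exists_signs_subgaussian`). -/

/-- `A i j = ⟪b i, c j⟫` for vectors with `‖b i‖ ≤ β` and `‖c j‖ ≤ κ` in a Euclidean space. -/
def HasFactorization {m n : Type*} (A : Matrix m n ℝ) (β κ : ℝ) : Prop :=
  ∃ (k : ℕ) (b : m → EuclideanSpace ℝ (Fin k)) (c : n → EuclideanSpace ℝ (Fin k)),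
    (∀ i j, inner ℝ (b i) (c j) = A i j) ∧ (∀ i, ‖b i‖ ≤ β) ∧ ∀ j, ‖c j‖ ≤ κ

/-! ### Vector factorizations and their tensor powers. -/

namespace HasFactorization

lemma of_fintype {m n ι : Type*} [Fintype ι] {A : Matrix m n ℝ} {β κ : ℝ}
    (b : m → ι → ℝ) (c : n → ι → ℝ) (hβ : 0 ≤ β) (hκ : 0 ≤ κ)
    (hA : ∀ i j, ∑ t, b i t * c j t = A i j)
    (hb : ∀ i, ∑ t, b i t ^ 2 ≤ β ^ 2) (hc : ∀ j, ∑ t, c j t ^ 2 ≤ κ ^ 2) :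
    HasFactorization A β κ := by
  let e := (Fintype.equivFin ι).symm
  have key : ∀ (f : ι → ℝ) (r : ℝ), 0 ≤ r → ∑ t, f t ^ 2 ≤ r ^ 2 →
      ‖WithLp.toLp 2 (fun t => f (e t))‖ ≤ r := by
    intro f r hr h
    rw [EuclideanSpace.norm_eq]
    refine Real.sqrt_le_iff.2 ⟨hr, ?_⟩
    simpa [Real.norm_eq_abs, sq_abs, e.sum_comp (fun t => f t ^ 2)] using h
  refine ⟨Fintype.card ι, fun i => WithLp.toLp 2 (fun t => b i (e t)),
    fun j => WithLp.toLp 2 (fun t => c j (e t)), ?_, fun i => key _ _ hβ (hb i),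
    fun j => key _ _ hκ (hc j)⟩
  intro i j
  rw [← hA i j, ← e.sum_comp]
  simp [PiLp.inner_apply, mul_comm]

lemma submatrix {m m' n : Type*} {A : Matrix m n ℝ} {β κ : ℝ} (h : HasFactorization A β κ)
    (r : m' → m) : HasFactorization (A.submatrix r id) β κ := by
  obtain ⟨k, b, c, hA, hb, hc⟩ := h
  exact ⟨k, fun i => b (r i), c, fun i j => hA _ _, fun i => hb _, hc⟩

/-- Tensor powers of factorizations. -/
lemma piPower {m n : Type*} {A : Matrix m n ℝ} {β κ : ℝ} (h : HasFactorization A β κ)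
    (hβ : 0 ≤ β) (hκ : 0 ≤ κ) (d : ℕ) :
    HasFactorization (fun (i : Fin d → m) (j : Fin d → n) => ∏ l, A (i l) (j l))
      (β ^ d) (κ ^ d) := by
  obtain ⟨k, b, c, hA, hb, hc⟩ := h
  have key : ∀ (u : Fin d → EuclideanSpace ℝ (Fin k)) (r : ℝ), 0 ≤ r → (∀ l, ‖u l‖ ≤ r) →
      ∑ t : Fin d → Fin k, (∏ l, u l (t l)) ^ 2 ≤ (r ^ d) ^ 2 := by
    intro u r hr hu
    simp_rw [← Finset.prod_pow]
    rw [← Fintype.prod_sum (fun l t => u l t ^ 2)]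
    calc ∏ l, ∑ t, u l t ^ 2 ≤ ∏ _l : Fin d, r ^ 2 := by
          refine Finset.prod_le_prod (fun l _ => Finset.sum_nonneg fun t _ => sq_nonneg _) ?_
          intro l _
          have := pow_le_pow_left₀ (norm_nonneg _) (hu l) 2
          rwa [EuclideanSpace.real_norm_sq_eq] at this
      _ = (r ^ d) ^ 2 := by simp [← pow_mul, mul_comm]
  refine of_fintype (ι := Fin d → Fin k) (fun i t => ∏ l, b (i l) (t l))
    (fun j t => ∏ l, c (j l) (t l)) (pow_nonneg hβ d) (pow_nonneg hκ d) ?_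
    (fun i => key _ _ hβ fun l => hb _) (fun j => key _ _ hκ fun l => hc _)
  intro i j
  simp_rw [← Finset.prod_mul_distrib]
  rw [← Fintype.prod_sum (fun l t => b (i l) t * c (j l) t)]
  refine Finset.prod_congr rfl fun l _ => ?_
  rw [← hA]
  simp [PiLp.inner_apply, mul_comm]

end HasFactorization

/-! ### Vector factorizations versus operator norms. -/

lemma gamma2_le {m n : Type*} [Fintype m] [Fintype n] {A : Matrix m n ℝ} {β κ : ℝ}
    (hβ : 0 ≤ β) (hκ : 0 ≤ κ) (h : HasFactorization A β κ) : DiscAP.gamma2 A ≤ β * κ := by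
  obtain ⟨k, b, c, hA, hb, hc⟩ := h
  let B : EuclideanSpace ℝ (Fin k) →L[ℝ] (m → ℝ) :=
    ContinuousLinearMap.pi fun i => innerSL ℝ (b i)
  let C : PiLp 1 (fun _ : n => ℝ) →L[ℝ] EuclideanSpace ℝ (Fin k) :=
    ∑ j, (PiLp.proj 1 (fun _ : n => ℝ) j).smulRight (c j)
  have hB : ‖B‖ ≤ β := by
    refine ContinuousLinearMap.opNorm_le_bound _ hβ fun x => ?_
    refine (pi_norm_le_iff_of_nonneg (by positivity)).2 fun i => ?_
    exact (norm_inner_le_norm (𝕜 := ℝ) (b i) x).trans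
      (mul_le_mul_of_nonneg_right (hb i) (norm_nonneg _))
  have hCx : ∀ x, C x = ∑ j, x j • c j := fun x => by
    simp [C]
  have hC : ‖C‖ ≤ κ := by
    refine ContinuousLinearMap.opNorm_le_bound _ hκ fun x => ?_
    rw [hCx, PiLp.norm_eq_of_L1, Finset.mul_sum]
    refine (norm_sum_le _ _).trans (Finset.sum_le_sum fun j _ => ?_)
    rw [norm_smul, mul_comm]
    exact mul_le_mul_of_nonneg_right (hc j) (norm_nonneg _)
  have hmem : ‖B‖ * ‖C‖ ∈ {t : ℝ | ∃ (k : ℕ) (B : EuclideanSpace ℝ (Fin k) →L[ℝ] (m → ℝ))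
    (C : PiLp 1 (fun _ : n => ℝ) →L[ℝ] EuclideanSpace ℝ (Fin k)),
    (∀ x, B (C x) = A *ᵥ WithLp.ofLp x) ∧ t = ‖B‖ * ‖C‖} := by
    refine ⟨k, B, C, fun x => ?_, rfl⟩
    ext i
    rw [hCx]
    simp [B, Matrix.mulVec, dotProduct, hA, mul_comm]
  refine (csInf_le ⟨0, ?_⟩ hmem).trans (mul_le_mul hB hC (norm_nonneg _) hβ)
  rintro t ⟨k, B, C, -, rfl⟩
  positivity

/-- The `2 → ∞` norm is the largest row norm and the `1 → 2` norm the largest column norm: rows come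
from Riesz representation, columns are images of basis vectors. The factorization `h₀` only ensures
that the infimum is over a nonempty set, since `sInf ∅ = 0`. -/
lemma le_gamma2 {m n : Type*} [Fintype m] [Fintype n] {A : Matrix m n ℝ} {x β₀ κ₀ : ℝ}
    (h₀ : HasFactorization A β₀ κ₀)
    (h : ∀ β κ, 0 ≤ β → 0 ≤ κ → HasFactorization A β κ → x ≤ β * κ) :
    x ≤ DiscAP.gamma2 A := by
  classical
  refine le_csInf ?_ ?_
  · obtain ⟨k, b, c, hA, -, -⟩ := h₀
    refine ⟨_, k, ContinuousLinearMap.pi fun i => innerSL ℝ (b i),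
      ∑ j, (PiLp.proj 1 (fun _ : n => ℝ) j).smulRight (c j), fun x => ?_, rfl⟩
    ext i
    simp [Matrix.mulVec, dotProduct, hA, mul_comm]
  · rintro t ⟨k, B, C, hBC, rfl⟩
    refine h _ _ (norm_nonneg _) (norm_nonneg _) ⟨k,
      fun i => (InnerProductSpace.toDual ℝ _).symm ((ContinuousLinearMap.proj i).comp B),
      fun j => C (PiLp.single 1 j 1), ?_, ?_, ?_⟩
    · intro i j
      rw [InnerProductSpace.toDual_symm_apply]
      simp [hBC]
    · intro i
      rw [LinearIsometryEquiv.norm_map]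
      refine ContinuousLinearMap.opNorm_le_bound _ (norm_nonneg _) fun x => ?_
      exact (norm_le_pi_norm (B x) i).trans (B.le_opNorm x)
    · intro j
      refine (C.le_opNorm _).trans ?_
      simp

/-! ### Lower bounds for factorizations from `ℓ₂` estimates. -/

/-- A matrix that is bounded below on `ℓ₂` has large `γ₂` norm. -/
lemma HasFactorization.card_le {m n : Type*} [Fintype m] [Fintype n] {A : Matrix m n ℝ}
    {β κ μ : ℝ} (h : HasFactorization A β κ) (hμ : 0 < μ)
    (hlow : ∀ f : n → ℝ, μ * ∑ j, f j ^ 2 ≤ ∑ i, (A *ᵥ f) i ^ 2) :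
    μ * Fintype.card n ≤ Fintype.card m * (β * κ) ^ 2 := by
  classical
  obtain ⟨k, b, c, hA, hb, hc⟩ := h
  have hdet : IsUnit (Aᵀ * A) := by
    rw [Matrix.isUnit_iff_isUnit_det, isUnit_iff_ne_zero]
    intro h0
    obtain ⟨v, hv, hv0⟩ := Matrix.exists_mulVec_eq_zero_iff.2 h0
    have h1 := hlow v
    have h2 : ∑ i, (A *ᵥ v) i ^ 2 = 0 := by
      rw [show ∑ i, (A *ᵥ v) i ^ 2 = (A *ᵥ v) ⬝ᵥ (A *ᵥ v) by simp [dotProduct, sq],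
        Matrix.dotProduct_mulVec, ← Matrix.mulVec_transpose, Matrix.mulVec_mulVec, hv0]
      simp
    rw [h2] at h1
    have h3 : ∑ j, v j ^ 2 = 0 :=
      le_antisymm (nonpos_of_mul_nonpos_right h1 hμ) (Finset.sum_nonneg fun _ _ => sq_nonneg _)
    refine hv (funext fun j => ?_)
    have := (Finset.sum_eq_zero_iff_of_nonneg (fun _ _ => sq_nonneg _)).1 h3 j (Finset.mem_univ j)
    simpa using this
  -- `G` is the pseudo-inverse: a left inverse of `A` for which `A * G` is the orthogonal projection
  -- onto the range of `A`. Hence `‖A G y‖ ≤ ‖y‖`, and the lower bound on `A` gives `μ ‖G y‖² ≤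
  -- ‖y‖²`.
  set G : Matrix n m ℝ := (Aᵀ * A)⁻¹ * Aᵀ with hG
  have hGA : G * A = 1 := by
    rw [hG, Matrix.mul_assoc, Matrix.nonsing_inv_mul _ ((Matrix.isUnit_iff_isUnit_det _).1 hdet)]
  have hAG : Aᵀ * A * G = Aᵀ := by
    rw [hG, ← Matrix.mul_assoc, Matrix.mul_nonsing_inv _ ((Matrix.isUnit_iff_isUnit_det _).1 hdet),
      Matrix.one_mul]
  have hGn : ∀ y : m → ℝ, μ * ∑ j, (G *ᵥ y) j ^ 2 ≤ ∑ i, y i ^ 2 := by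
    intro y
    refine (hlow _).trans ?_
    set z := A *ᵥ (G *ᵥ y) with hz
    have h1 : ∑ i, z i ^ 2 = ∑ i, z i * y i := by
      have adj : ∀ w, z ⬝ᵥ w = (G *ᵥ y) ⬝ᵥ (Aᵀ *ᵥ w) := fun w => by
        rw [hz, Matrix.dotProduct_mulVec, ← Matrix.mulVec_transpose, Matrix.transpose_transpose]
      rw [show ∑ i, z i ^ 2 = z ⬝ᵥ z by simp [dotProduct, sq],
        show ∑ i, z i * y i = z ⬝ᵥ y from rfl, adj, adj, hz, Matrix.mulVec_mulVec,
        Matrix.mulVec_mulVec, hAG]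
    have h2 : 0 ≤ ∑ i, (y i - z i) ^ 2 := Finset.sum_nonneg fun _ _ => sq_nonneg _
    have h3 : ∑ i, (y i - z i) ^ 2 = ∑ i, y i ^ 2 - 2 * ∑ i, z i * y i + ∑ i, z i ^ 2 := by
      rw [Finset.mul_sum, ← Finset.sum_sub_distrib, ← Finset.sum_add_distrib]
      exact Finset.sum_congr rfl fun _ _ => by ring
    linarith
  -- With `A = B C`, the number of columns is `tr (G B C)`, which Cauchy-Schwarz bounds by the
  -- Frobenius norms of `G B` and `C`.
  have htr : (Fintype.card n : ℝ) = ∑ j, ∑ t, (∑ i, G j i * b i t) * c j t := by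
    have : (Fintype.card n : ℝ) = (G * A).trace := by rw [hGA]; simp
    rw [this, Matrix.trace]
    refine Finset.sum_congr rfl fun j _ => ?_
    simp only [Matrix.diag_apply, Matrix.mul_apply, ← hA, PiLp.inner_apply]
    simp_rw [Finset.mul_sum, Finset.sum_mul]
    rw [Finset.sum_comm]
    refine Finset.sum_congr rfl fun i _ => Finset.sum_congr rfl fun t _ => ?_
    simp; ring
  have hbF : ∑ t, ∑ i, b i t ^ 2 ≤ Fintype.card m * β ^ 2 := by
    rw [Finset.sum_comm]
    calc ∑ i, ∑ t, b i t ^ 2 ≤ ∑ _i : m, β ^ 2 := by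
          refine Finset.sum_le_sum fun i _ => ?_
          rw [← EuclideanSpace.real_norm_sq_eq]
          exact pow_le_pow_left₀ (norm_nonneg _) (hb i) 2
      _ = _ := by simp
  have hcF : ∑ j, ∑ t, c j t ^ 2 ≤ Fintype.card n * κ ^ 2 := by
    calc ∑ j, ∑ t, c j t ^ 2 ≤ ∑ _j : n, κ ^ 2 := by
          refine Finset.sum_le_sum fun i _ => ?_
          rw [← EuclideanSpace.real_norm_sq_eq]
          exact pow_le_pow_left₀ (norm_nonneg _) (hc i) 2
      _ = _ := by simp
  have hGB : μ * ∑ j, ∑ t, (∑ i, G j i * b i t) ^ 2 ≤ Fintype.card m * β ^ 2 := by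
    refine le_trans ?_ hbF
    rw [Finset.sum_comm, Finset.mul_sum]
    exact Finset.sum_le_sum fun t _ => hGn fun i => b i t
  have hcs : (Fintype.card n : ℝ) ^ 2 ≤
      (∑ j, ∑ t, (∑ i, G j i * b i t) ^ 2) * ∑ j, ∑ t, c j t ^ 2 := by
    rw [htr]
    simp only [← Fintype.sum_prod_type']
    exact Finset.sum_mul_sq_le_sq_mul_sq _ _ _
  rcases Nat.eq_zero_or_pos (Fintype.card n) with h0 | h0
  · rw [h0]; simp; positivity
  have hn : (0 : ℝ) < Fintype.card n := by exact_mod_cast h0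
  have h1 : μ * (Fintype.card n : ℝ) ^ 2 ≤
      (Fintype.card m * β ^ 2) * (Fintype.card n * κ ^ 2) := by
    calc _ ≤ (μ * ∑ j, ∑ t, (∑ i, G j i * b i t) ^ 2) * ∑ j, ∑ t, c j t ^ 2 := by
          rw [mul_assoc]; exact mul_le_mul_of_nonneg_left hcs hμ.le
      _ ≤ _ := mul_le_mul hGB hcF
        (Finset.sum_nonneg fun _ _ => Finset.sum_nonneg fun _ _ => sq_nonneg _) (by positivity)
  refine le_of_mul_le_mul_right ?_ hn
  calc _ = μ * (Fintype.card n : ℝ) ^ 2 := by ring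
    _ ≤ _ := h1
    _ = _ := by ring

lemma sum_pi_fin_succ {ι : Type*} [Fintype ι] {d : ℕ} (g : (Fin (d + 1) → ι) → ℝ) :
    ∑ i, g i = ∑ i₀ : ι, ∑ i : Fin d → ι, g (Fin.cons (α := fun _ => ι) i₀ i) := by
  rw [← (Fin.consEquiv fun _ => ι).sum_comp, Fintype.sum_prod_type]
  rfl

/-- Tensor powers of lower `ℓ₂` bounds. -/
lemma piPower_lower_bound {m n : Type*} [Fintype m] [Fintype n] {A : Matrix m n ℝ} {μ : ℝ}
    (hμ : 0 ≤ μ) (hlow : ∀ f : n → ℝ, μ * ∑ j, f j ^ 2 ≤ ∑ i, (A *ᵥ f) i ^ 2) (d : ℕ)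
    (f : (Fin d → n) → ℝ) :
    μ ^ d * ∑ j, f j ^ 2 ≤ ∑ i : Fin d → m, (∑ j : Fin d → n, (∏ l, A (i l) (j l)) * f j) ^ 2 := by
  induction d with
  | zero => simp
  | succ d ih =>
    rw [sum_pi_fin_succ, sum_pi_fin_succ (ι := m)]
    calc μ ^ (d + 1) * ∑ j₀, ∑ j, f (Fin.cons (α := fun _ => n) j₀ j) ^ 2
        = μ * ∑ j₀, μ ^ d * ∑ j, f (Fin.cons (α := fun _ => n) j₀ j) ^ 2 := by
          rw [← Finset.mul_sum]; ring
      _ ≤ μ * ∑ j₀, ∑ i : Fin d → m,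
            (∑ j : Fin d → n, (∏ l, A (i l) (j l)) * f (Fin.cons (α := fun _ => n) j₀ j)) ^ 2 :=
          mul_le_mul_of_nonneg_left (Finset.sum_le_sum fun j₀ _ => ih _) hμ
      _ = ∑ i : Fin d → m, μ * ∑ j₀,
            (∑ j : Fin d → n, (∏ l, A (i l) (j l)) * f (Fin.cons (α := fun _ => n) j₀ j)) ^ 2 := by
          rw [Finset.sum_comm, Finset.mul_sum]
      _ ≤ ∑ i : Fin d → m, ∑ i₀, (∑ j : Fin (d + 1) → n,
            (∏ l, A (Fin.cons (α := fun _ => m) i₀ i l) (j l)) * f j) ^ 2 := by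
          refine Finset.sum_le_sum fun i _ => (hlow _).trans (le_of_eq ?_)
          refine Finset.sum_congr rfl fun i₀ _ => ?_
          rw [sum_pi_fin_succ]
          simp only [Matrix.mulVec, dotProduct, Fin.prod_univ_succ, Fin.cons_zero, Fin.cons_succ,
            Finset.mul_sum, mul_assoc]
      _ = _ := Finset.sum_comm

/-! ### The one-variable potential of the Gram-Schmidt walk. -/

/-- The logarithm of the potential that the pivot of the Gram-Schmidt walk contributes. -/
noncomputable def walkPotential (a s A x : ℝ) : ℝ :=
  if A ≤ 16 / 625 then min (25 * A * (1 - x ^ 2 / 2)) (|a| - a * x + (1 - s) / 25)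
  else |a| - a * x + (1 - s) / 25

namespace walkPotential

variable {a s A x : ℝ}

lemma mul_le_abs (hx : |x| ≤ 1) : a * x ≤ |a| := by
  calc a * x ≤ |a * x| := le_abs_self _
    _ = |a| * |x| := abs_mul _ _
    _ ≤ |a| * 1 := mul_le_mul_of_nonneg_left hx (abs_nonneg _)
    _ = |a| := mul_one _

lemma sq_le (hx : |x| ≤ 1) : x ^ 2 ≤ 1 := by
  rw [← sq_abs]; exact pow_le_one₀ (abs_nonneg _) hx

lemma nonneg (hA : 0 ≤ A) (hs : s ≤ 1) (hx : |x| ≤ 1) : 0 ≤ walkPotential a s A x := by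
  have h1 := mul_le_abs (a := a) hx
  have h2 := sq_le hx
  have h3 : 0 ≤ |a| - a * x + (1 - s) / 25 := by linarith
  unfold walkPotential
  split_ifs
  · exact le_min (mul_nonneg (by linarith) (by linarith)) h3
  · exact h3

/-- With `s = h²` and `A = α²`, the left side is at most `2 h α + (1 - h²) / 25`, which increases in
`h ≤ 1` here; at `h = 1` the claim is `α ≥ 4 / 25`, the threshold. The bound `25 * A / 2` is the
minimum of the Gaussian branch on `[-1, 1]`, so switching branches costs nothing. -/
lemma linear_le (hs0 : 0 ≤ s) (hs : s ≤ 1) (hx : |x| ≤ 1) (ha : a ^ 2 ≤ s * A)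
    (hA : 16 / 625 < A) : |a| - a * x + (1 - s) / 25 ≤ 25 * A / 2 := by
  have hA0 : 0 ≤ A := by linarith
  obtain ⟨h, hh0, rfl⟩ : ∃ h, 0 ≤ h ∧ s = h ^ 2 := ⟨√s, Real.sqrt_nonneg _, (Real.sq_sqrt hs0).symm⟩
  obtain ⟨α, hα0, rfl⟩ : ∃ α, 0 ≤ α ∧ A = α ^ 2 := ⟨√A, Real.sqrt_nonneg _, (Real.sq_sqrt hA0).symm⟩
  have h1 : |a| ≤ h * α := abs_le_of_sq_le_sq (by rwa [mul_pow]) (by positivity)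
  have h2 : -(a * x) ≤ |a| := by
    have := mul_le_abs (a := -a) hx
    rw [abs_neg] at this
    linarith
  have h3 : h ≤ 1 := by nlinarith
  have h4 : 4 / 25 ≤ α := by nlinarith
  nlinarith [mul_nonneg (sub_nonneg.2 h3) (by linarith : 0 ≤ 2 * α - (1 + h) / 25),
    mul_nonneg hα0 (sub_nonneg.2 h4)]

lemma le_mul (hA : 0 ≤ A) (hs0 : 0 ≤ s) (hs : s ≤ 1) (hx : |x| ≤ 1) (ha : a ^ 2 ≤ s * A) :
    walkPotential a s A x ≤ 25 * A := by
  unfold walkPotential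
  split_ifs with h
  · exact (min_le_left _ _).trans (by nlinarith [mul_nonneg hA (sq_nonneg x)])
  · exact (linear_le hs0 hs hx ha (not_le.1 h)).trans (by linarith)

/-- Used when a vector other than the pivot is frozen: `b` is the energy of `θ` that the span of the
remaining vectors loses. The reserve `(1 - s) / 25` pays for the change of the slope `a`. -/
lemma transition {a' s' A' b : ℝ} (hA : 0 ≤ A) (hs0 : 0 ≤ s) (hss : s ≤ s') (hs : s' ≤ 1)
    (hx : |x| ≤ 1) (ha' : a' ^ 2 ≤ s' * A') (hb : 0 ≤ b)
    (haa : (a' - a) ^ 2 ≤ (s' - s) * b) (hAA : A' ≤ A + b) :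
    walkPotential a' s' A' x ≤ walkPotential a s A x + 25 * b := by
  have h2 := sq_le hx
  -- AM-GM applied to `(s' - s) / 25` and `25 * b`, whose product bounds `(a' - a) ^ 2`.
  have hd : |a' - a| ≤ ((s' - s) / 25 + 25 * b) / 2 := by
    refine abs_le_of_sq_le_sq (haa.trans ?_) (by linarith)
    nlinarith [sq_nonneg ((s' - s) / 25 - 25 * b)]
  have hl : |a'| - a' * x + (1 - s') / 25 ≤ |a| - a * x + (1 - s) / 25 + 25 * b := by
    have h3 := mul_le_abs (a := a - a') hx
    rw [abs_sub_comm] at h3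
    have h4 := abs_sub_abs_le_abs_sub a' a
    linarith
  have hA1 : A ≤ 16 / 625 → 16 / 625 < A' →
      |a'| - a' * x + (1 - s') / 25 ≤ 25 * A * (1 - x ^ 2 / 2) + 25 * b := fun _ h' => by
    refine (linear_le (hs0.trans hss) hs hx ha' h').trans ?_
    nlinarith [mul_nonneg hA (sub_nonneg.2 h2)]
  have hA2 : 25 * A' * (1 - x ^ 2 / 2) ≤ 25 * A * (1 - x ^ 2 / 2) + 25 * b := by
    nlinarith [mul_nonneg (sub_nonneg.2 hAA) (by linarith : 0 ≤ 1 - x ^ 2 / 2),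
      mul_nonneg hb (sq_nonneg x)]
  unfold walkPotential
  split_ifs with h h' h'
  · rw [← min_add_add_right]
    exact min_le_min hA2 hl
  · exact (min_le_right _ _).trans hl
  · rw [← min_add_add_right]
    exact le_min (hA1 h' (not_le.1 h)) hl
  · exact hl

lemma concaveOn_gaussian (ha : a ^ 2 ≤ A) (hA : A ≤ 16 / 625) :
    ConcaveOn ℝ (Set.Icc (-1) 1) fun x => Real.exp (a * x + 25 * A * (1 - x ^ 2 / 2)) := by
  have hp : ∀ x : ℝ, HasDerivAt (fun x => a * x + 25 * A * (1 - x ^ 2 / 2)) (a - 25 * A * x) x := by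
    intro x
    have := ((hasDerivAt_id x).const_mul a).add
      ((((hasDerivAt_pow 2 x).div_const 2).const_sub 1).const_mul (25 * A))
    refine this.congr_deriv ?_
    simp; ring
  have hf : ∀ x : ℝ, HasDerivAt (fun x => Real.exp (a * x + 25 * A * (1 - x ^ 2 / 2)))
      (Real.exp (a * x + 25 * A * (1 - x ^ 2 / 2)) * (a - 25 * A * x)) x := fun x => (hp x).exp
  have hf' : ∀ x : ℝ, HasDerivAt
      (fun x => Real.exp (a * x + 25 * A * (1 - x ^ 2 / 2)) * (a - 25 * A * x))
      (Real.exp (a * x + 25 * A * (1 - x ^ 2 / 2)) * ((a - 25 * A * x) ^ 2 - 25 * A)) x := by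
    intro x
    refine ((hf x).mul (((hasDerivAt_id x).const_mul (25 * A)).const_sub a)).congr_deriv ?_
    simp; ring
  refine concaveOn_of_hasDerivWithinAt2_nonpos (convex_Icc _ _)
    (fun x _ => (hf x).continuousAt.continuousWithinAt)
    (fun x _ => (hf x).hasDerivWithinAt) (fun x _ => (hf' x).hasDerivWithinAt) ?_
  intro x hx
  have hx := abs_le.2 (interior_subset hx : x ∈ Set.Icc (-1 : ℝ) 1)
  refine mul_nonpos_of_nonneg_of_nonpos (Real.exp_pos _).le ?_
  have hA0 : 0 ≤ A := (sq_nonneg a).trans ha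
  obtain ⟨α, hα0, rfl⟩ : ∃ α, 0 ≤ α ∧ A = α ^ 2 := ⟨√A, Real.sqrt_nonneg _, (Real.sq_sqrt hA0).symm⟩
  have h1 : |a| ≤ α := abs_le_of_sq_le_sq ha hα0
  -- The threshold on `A` is what makes `25 * α ^ 2 ≤ 4 * α`, so the logarithmic derivative is at
  -- most `5 * α` and its square at most `25 * A`.
  have h2 : α ≤ 4 / 25 := by nlinarith
  have h3 : |a - 25 * α ^ 2 * x| ≤ 5 * α := by
    calc |a - 25 * α ^ 2 * x| ≤ |a| + |25 * α ^ 2 * x| := abs_sub _ _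
      _ = |a| + 25 * α ^ 2 * |x| := by rw [abs_mul, abs_of_nonneg (by positivity : 0 ≤ 25 * α ^ 2)]
      _ ≤ α + 25 * α ^ 2 * 1 := by gcongr
      _ ≤ 5 * α := by nlinarith
  have h4 := sq_le_sq' (abs_le.1 h3).1 (abs_le.1 h3).2
  linarith

/-- In the linear branch the term `a * x` cancels and the function is constant; a minimum of concave
functions is concave. -/
lemma concaveOn (ha : a ^ 2 ≤ A) :
    ConcaveOn ℝ (Set.Icc (-1) 1) fun x => Real.exp (a * x + walkPotential a s A x) := by
  have hl : ConcaveOn ℝ (Set.Icc (-1 : ℝ) 1)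
      fun x => Real.exp (a * x + (|a| - a * x + (1 - s) / 25)) := by
    have : (fun x => Real.exp (a * x + (|a| - a * x + (1 - s) / 25))) =
        fun _ => Real.exp (|a| + (1 - s) / 25) := by
      ext x; ring_nf
    rw [this]
    exact concaveOn_const _ (convex_Icc _ _)
  by_cases h : A ≤ 16 / 625
  · have : (fun x => Real.exp (a * x + walkPotential a s A x)) =
        (fun x => Real.exp (a * x + 25 * A * (1 - x ^ 2 / 2))) ⊓
          fun x => Real.exp (a * x + (|a| - a * x + (1 - s) / 25)) := by
      ext x
      simp only [walkPotential, if_pos h, ← min_add_add_left, Real.exp_monotone.map_min]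
      rfl
    rw [this]
    exact (concaveOn_gaussian ha h).inf hl
  · simpa only [walkPotential, if_neg h] using hl

end walkPotential

set_option linter.unusedSectionVars false

/-! ### The Gram-Schmidt walk, derandomized. -/

section GramSchmidtWalk

variable {E : Type*} [NormedAddCommGroup E] [InnerProductSpace ℝ E] [FiniteDimensional ℝ E]

lemma inner_starProjection_sub_sub {W U : Submodule ℝ E} (h : W ≤ U) (y z : E) :
    inner ℝ (U.starProjection y - W.starProjection y) (U.starProjection z - W.starProjection z) =
      inner ℝ (U.starProjection y) z - inner ℝ (W.starProjection y) z := by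
  have hWU : ∀ t, U.starProjection (W.starProjection t) = W.starProjection t := fun t =>
    Submodule.starProjection_eq_self_iff.2 (h (Submodule.starProjection_apply_mem W t))
  have hUU : ∀ t, U.starProjection (U.starProjection t) = U.starProjection t := fun t =>
    Submodule.starProjection_eq_self_iff.2 (Submodule.starProjection_apply_mem U t)
  have hWW : ∀ t, W.starProjection (W.starProjection t) = W.starProjection t := fun t =>
    Submodule.starProjection_eq_self_iff.2 (Submodule.starProjection_apply_mem W t)
  have e1 : inner ℝ (U.starProjection y) (U.starProjection z) = inner ℝ (U.starProjection y) z := by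
    rw [← Submodule.inner_starProjection_left_eq_right, hUU]
  have e2 : inner ℝ (W.starProjection y) (W.starProjection z) = inner ℝ (W.starProjection y) z := by
    rw [← Submodule.inner_starProjection_left_eq_right, hWW]
  have e3 : inner ℝ (W.starProjection y) (U.starProjection z) = inner ℝ (W.starProjection y) z := by
    rw [← Submodule.inner_starProjection_left_eq_right, hWU]
  have e4 : inner ℝ (U.starProjection y) (W.starProjection z) = inner ℝ (W.starProjection y) z := by
    rw [Submodule.inner_starProjection_left_eq_right, hWU,
      ← Submodule.inner_starProjection_left_eq_right]
  rw [inner_sub_left, inner_sub_right, inner_sub_right, e1, e2, e3, e4]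
  ring

lemma norm_starProjection_sub_sq {W U : Submodule ℝ E} (h : W ≤ U) (y : E) :
    ‖U.starProjection y - W.starProjection y‖ ^ 2 =
      ‖U.starProjection y‖ ^ 2 - ‖W.starProjection y‖ ^ 2 := by
  have key : ∀ V : Submodule ℝ E, inner ℝ (V.starProjection y) y = ‖V.starProjection y‖ ^ 2 :=
    fun V => by
      have := Submodule.starProjection_eq_self_iff.2 (Submodule.starProjection_apply_mem V y)
      rw [← real_inner_self_eq_norm_sq, ← Submodule.inner_starProjection_left_eq_right, this]
  rw [← real_inner_self_eq_norm_sq, inner_starProjection_sub_sub h, key, key]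

lemma norm_starProjection_sq_mono {W U : Submodule ℝ E} (h : W ≤ U) (y : E) :
    ‖W.starProjection y‖ ^ 2 ≤ ‖U.starProjection y‖ ^ 2 := by
  have := norm_starProjection_sub_sq h y
  have := sq_nonneg ‖U.starProjection y - W.starProjection y‖
  linarith

/-- Cauchy-Schwarz for the projection onto the orthogonal complement of `W` in `U`. It supplies both
`a ^ 2 ≤ s * A` and the hypothesis on `a' - a` in `walkPotential.transition`. -/
lemma inner_starProjection_sub_sq_le {W U : Submodule ℝ E} (h : W ≤ U) (y z : E) :
    inner ℝ (U.starProjection y - W.starProjection y) z ^ 2 ≤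
      (‖U.starProjection y‖ ^ 2 - ‖W.starProjection y‖ ^ 2) *
        (‖U.starProjection z‖ ^ 2 - ‖W.starProjection z‖ ^ 2) := by
  rw [inner_sub_left, ← inner_starProjection_sub_sub h, ← norm_starProjection_sub_sq h,
    ← norm_starProjection_sub_sq h, ← mul_pow, ← sq_abs]
  exact pow_le_pow_left₀ (abs_nonneg _) (abs_real_inner_le_norm _ _) 2

/-- A ray starting in the cube `[-1, 1]^ι` leaves it through a facet. -/
lemma exists_cube_exit {ι : Type*} [Fintype ι] (x u : ι → ℝ) (hx : ∀ i, |x i| ≤ 1)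
    (hu : ∃ i, u i ≠ 0) :
    ∃ δ, 0 ≤ δ ∧ (∀ i, |x i + δ * u i| ≤ 1) ∧ ∃ i, u i ≠ 0 ∧ |x i + δ * u i| = 1 := by
  classical
  obtain ⟨i₀, hi₀⟩ := hu
  -- The time at which coordinate `i` reaches the sign of `u i`; the exit happens at the smallest
  -- such time.
  let t : ι → ℝ := fun i => (|u i| - u i * x i) / u i ^ 2
  have hend : ∀ i, u i ≠ 0 → x i + t i * u i = |u i| / u i := by
    intro i hi
    simp only [t]
    field_simp
    ring
  have habs : ∀ i, u i ≠ 0 → |x i + t i * u i| = 1 := by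
    intro i hi
    rw [hend i hi, abs_div, abs_abs, div_self (abs_ne_zero.2 hi)]
  have ht0 : ∀ i, 0 ≤ t i := fun i =>
    div_nonneg (sub_nonneg.2 (walkPotential.mul_le_abs (hx i))) (sq_nonneg _)
  obtain ⟨i, hi, hmin⟩ := (Finset.univ.filter fun i => u i ≠ 0).exists_min_image t
    ⟨i₀, by simpa using hi₀⟩
  have hi : u i ≠ 0 := by simpa using hi
  refine ⟨t i, ht0 i, fun l => ?_, i, hi, habs i hi⟩
  by_cases hl : u l = 0
  · simpa [hl] using hx l
  have h1 := hmin l (by simpa using hl)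
  have h2 := abs_le.1 (habs l hl).le
  have h3 := abs_le.1 (hx l)
  have h4 := ht0 i
  rw [abs_le]
  rcases le_total 0 (u l) with h | h
  · constructor <;> nlinarith
  · constructor <;> nlinarith

variable {ι J : Type*} [Fintype ι] [DecidableEq ι] [Fintype J]

/-- The span of the vectors indexed by `A`. -/
abbrev spanOn (v : ι → E) (A : Finset ι) : Submodule ℝ E :=
  Submodule.span ℝ (v '' A)

lemma spanOn_mono (v : ι → E) {A B : Finset ι} (h : A ⊆ B) : spanOn v A ≤ spanOn v B :=
  Submodule.span_mono (Set.image_mono (by exact_mod_cast h))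

/-- The logarithm of the potential of the Gram-Schmidt walk in direction `θ`, with alive set `A` and
pivot `p` at position `y`. -/
noncomputable def walkExponent (v : ι → E) (A : Finset ι) (p : ι) (θ : E) (y : ℝ) : ℝ :=
  25 * ‖(spanOn v (A.erase p)).starProjection θ‖ ^ 2 +
    walkPotential (inner ℝ (v p - (spanOn v (A.erase p)).starProjection (v p)) θ)
      (‖v p‖ ^ 2 - ‖(spanOn v (A.erase p)).starProjection (v p)‖ ^ 2)
      (‖(spanOn v A).starProjection θ‖ ^ 2 - ‖(spanOn v (A.erase p)).starProjection θ‖ ^ 2) y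

section

variable {v : ι → E} (hv : ∀ i, ‖v i‖ ≤ 1) {A : Finset ι} {p : ι} (hp : p ∈ A) (θ : E)
include hp

lemma starProjection_spanOn_self : (spanOn v A).starProjection (v p) = v p :=
  Submodule.starProjection_eq_self_iff.2 (Submodule.subset_span ⟨p, hp, rfl⟩)

lemma walk_inner_sq_le :
    inner ℝ (v p - (spanOn v (A.erase p)).starProjection (v p)) θ ^ 2 ≤
      (‖v p‖ ^ 2 - ‖(spanOn v (A.erase p)).starProjection (v p)‖ ^ 2) *
      (‖(spanOn v A).starProjection θ‖ ^ 2 -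
        ‖(spanOn v (A.erase p)).starProjection θ‖ ^ 2) := by
  have := inner_starProjection_sub_sq_le (spanOn_mono v (A.erase_subset p)) (v p) θ
  rwa [starProjection_spanOn_self hp] at this

lemma walk_height_nonneg :
    0 ≤ ‖v p‖ ^ 2 - ‖(spanOn v (A.erase p)).starProjection (v p)‖ ^ 2 := by
  have := norm_starProjection_sq_mono (spanOn_mono v (A.erase_subset p)) (v p)
  rw [starProjection_spanOn_self hp] at this
  linarith

omit hp in
lemma walk_energy_nonneg :
    0 ≤ ‖(spanOn v A).starProjection θ‖ ^ 2 -
      ‖(spanOn v (A.erase p)).starProjection θ‖ ^ 2 :=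
  sub_nonneg.2 (norm_starProjection_sq_mono (spanOn_mono v (A.erase_subset p)) θ)

include hv

omit hp in
lemma walk_height_le_one :
    ‖v p‖ ^ 2 - ‖(spanOn v (A.erase p)).starProjection (v p)‖ ^ 2 ≤ 1 := by
  have := pow_le_one₀ (norm_nonneg _) (hv p) (n := 2)
  have := sq_nonneg ‖(spanOn v (A.erase p)).starProjection (v p)‖
  linarith

lemma walkExponent_le {y : ℝ} (hy : |y| ≤ 1) :
    walkExponent v A p θ y ≤ 25 * ‖(spanOn v A).starProjection θ‖ ^ 2 := by
  have := walkPotential.le_mul (walk_energy_nonneg (v := v) (A := A) (p := p) θ)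
    (walk_height_nonneg hp) (walk_height_le_one hv) hy (walk_inner_sq_le hp θ)
  unfold walkExponent
  linarith

omit hp in
lemma le_walkExponent {y : ℝ} (hy : |y| ≤ 1) :
    25 * ‖(spanOn v (A.erase p)).starProjection θ‖ ^ 2 ≤ walkExponent v A p θ y := by
  have := walkPotential.nonneg (a := inner ℝ (v p - (spanOn v (A.erase p)).starProjection (v p)) θ)
    (walk_energy_nonneg (v := v) (A := A) (p := p) θ) (walk_height_le_one hv (A := A) (p := p)) hy
  unfold walkExponent
  linarith

lemma walkExponent_erase_le {i : ι} (hi : i ≠ p) {y : ℝ} (hy : |y| ≤ 1) :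
    walkExponent v (A.erase i) p θ y ≤ walkExponent v A p θ y := by
  have hp' : p ∈ A.erase i := Finset.mem_erase.2 ⟨hi.symm, hp⟩
  have hW : spanOn v ((A.erase i).erase p) ≤ spanOn v (A.erase p) :=
    spanOn_mono v (Finset.erase_subset_erase _ (A.erase_subset i))
  have h1 := norm_starProjection_sq_mono hW θ
  have h2 := norm_starProjection_sq_mono hW (v p)
  have h3 := norm_starProjection_sq_mono (spanOn_mono v (A.erase_subset i)) θ
  have h4 := inner_starProjection_sub_sq_le hW (v p) θ
  have h5 := walkPotential.transition (walk_energy_nonneg (v := v) (A := A) (p := p) θ)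
    (walk_height_nonneg hp) (sub_le_sub_left h2 (‖v p‖ ^ 2)) (walk_height_le_one hv) hy
    (walk_inner_sq_le hp' θ) (sub_nonneg.2 h1)
    (a := inner ℝ (v p - (spanOn v (A.erase p)).starProjection (v p)) θ)
    (by
      rw [← inner_sub_left, sub_sub_sub_cancel_left]
      refine h4.trans (le_of_eq ?_)
      ring)
    (by linarith)
  unfold walkExponent
  linarith

end

/-- Moving along `u` shifts the signed sum only by multiples of the component of `v p` orthogonal to
the other alive vectors. -/
lemma exists_walk_direction (v : ι → E) (A : Finset ι) {p : ι} :
    ∃ u : ι → ℝ, u p = 1 ∧ (∀ i, i ∉ A → i ≠ p → u i = 0) ∧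
      ∑ i, u i • v i = v p - (spanOn v (A.erase p)).starProjection (v p) := by
  obtain ⟨c, hc⟩ := Submodule.mem_span_image_finset_iff_exists_fun' ℝ |>.1
    (Submodule.starProjection_apply_mem (spanOn v (A.erase p)) (v p))
  refine ⟨fun i => if i = p then 1 else if i ∈ A then - c i else 0, by simp, ?_, ?_⟩
  · intro i hi hip
    simp [hi, hip]
  · rw [← hc, ← Finset.add_sum_erase _ _ (Finset.mem_univ p), sub_eq_add_neg, ← Finset.sum_neg_distrib]
    simp only [if_true, one_smul]
    congr 1
    refine (Finset.sum_subset_zero_on_sdiff (Finset.erase_subset_erase p A.subset_univ)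
      (fun i hi => ?_) fun i hi => ?_).symm
    · simp only [Finset.mem_sdiff, Finset.mem_erase, Finset.mem_univ, and_true, not_and] at hi
      simp [hi.1, hi.2 hi.1]
    · rw [Finset.mem_erase] at hi
      simp [hi.1, hi.2]

/-- Induction on the number of alive coordinates. The weights `c` accumulate the exponential factors
of the moves already made. The walk would move at random to one of two facets; concavity of the
weighted potential shows that one of the two choices does not increase it. -/
lemma exists_signs_walk {v : ι → E} (hv : ∀ i, ‖v i‖ ≤ 1) (θ : J → E) (N : ℕ) :
    ∀ (A : Finset ι) (p : ι) (x : ι → ℝ) (c : J → ℝ), A.card = N → p ∈ A → (∀ i, |x i| ≤ 1) →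
      (∀ i, i ∉ A → |x i| = 1) → (∀ j, 0 ≤ c j) →
      ∃ ε : ι → ℝ, (∀ i, |ε i| = 1) ∧
        ∑ j, c j * Real.exp (inner ℝ (∑ i, (ε i - x i) • v i) (θ j)) ≤
          ∑ j, c j * Real.exp (walkExponent v A p (θ j) (x p)) := by
  induction N with
  | zero =>
    intro A p x c hA hp
    rw [Finset.card_eq_zero.1 hA] at hp
    exact absurd hp (Finset.notMem_empty p)
  | succ N ih =>
    intro A p x c hA hp hx hxA hc
    -- the case where some alive coordinate has reached the boundary
    have frozen : ∀ (x : ι → ℝ) (c : J → ℝ), (∀ i, |x i| ≤ 1) → (∀ i, i ∉ A → |x i| = 1) →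
        (∀ j, 0 ≤ c j) → (∃ i ∈ A, |x i| = 1) →
        ∃ ε : ι → ℝ, (∀ i, |ε i| = 1) ∧
          ∑ j, c j * Real.exp (inner ℝ (∑ i, (ε i - x i) • v i) (θ j)) ≤
            ∑ j, c j * Real.exp (walkExponent v A p (θ j) (x p)) := by
      rintro x c hx hxA hc ⟨i, hi, hxi⟩
      have hcard : (A.erase i).card = N := by rw [Finset.card_erase_of_mem hi, hA]; rfl
      have hxA' : ∀ l, l ∉ A.erase i → |x l| = 1 := by
        intro l hl
        by_cases hli : l = i
        · rwa [hli]
        · exact hxA l fun h => hl (Finset.mem_erase.2 ⟨hli, h⟩)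
      by_cases hip : i = p
      -- A frozen pivot is replaced by any other alive `q`: the exponents before and after are
      -- separated by `25` times the squared projection onto the span of `A.erase i`.
      · subst hip
        rcases (A.erase i).eq_empty_or_nonempty with h | ⟨q, hq⟩
        · refine ⟨x, fun l => hxA' l (by simp [h]), ?_⟩
          refine Finset.sum_le_sum fun j _ => mul_le_mul_of_nonneg_left ?_ (hc j)
          refine Real.exp_le_exp.2 (le_trans ?_ (le_walkExponent hv (θ j) (hx i)))
          simp only [sub_self, zero_smul, Finset.sum_const_zero, inner_zero_left]
          positivity
        · obtain ⟨ε, hε, hle⟩ := ih (A.erase i) q x c hcard hq hx hxA' hc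
          refine ⟨ε, hε, hle.trans ?_⟩
          refine Finset.sum_le_sum fun j _ => mul_le_mul_of_nonneg_left ?_ (hc j)
          exact Real.exp_le_exp.2
            ((walkExponent_le hv hq (θ j) (hx q)).trans (le_walkExponent hv (θ j) (hx i)))
      · obtain ⟨ε, hε, hle⟩ := ih (A.erase i) p x c hcard
          (Finset.mem_erase.2 ⟨Ne.symm hip, hp⟩) hx hxA' hc
        refine ⟨ε, hε, hle.trans ?_⟩
        refine Finset.sum_le_sum fun j _ => mul_le_mul_of_nonneg_left ?_ (hc j)
        exact Real.exp_le_exp.2 (walkExponent_erase_le hv hp (θ j) hip (hx p))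
    obtain ⟨u, hup, huA, huv⟩ := exists_walk_direction v A (p := p)
    set w := v p - (spanOn v (A.erase p)).starProjection (v p) with hw
    -- after a move to `x + δ u`
    have move : ∀ δ : ℝ, (∀ i, |x i + δ * u i| ≤ 1) → (∃ i, u i ≠ 0 ∧ |x i + δ * u i| = 1) →
        ∃ ε : ι → ℝ, (∀ i, |ε i| = 1) ∧
          ∑ j, c j * Real.exp (inner ℝ (∑ i, (ε i - x i) • v i) (θ j)) ≤
            ∑ j, c j * Real.exp (δ * inner ℝ w (θ j) + walkExponent v A p (θ j) (x p + δ)) := by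
      rintro δ hδ ⟨i, hui, hi⟩
      have hiA : i ∈ A := by
        by_contra h
        exact hui (huA i h fun hip => h (hip ▸ hp))
      obtain ⟨ε, hε, hle⟩ := frozen (fun i => x i + δ * u i)
        (fun j => c j * Real.exp (δ * inner ℝ w (θ j))) hδ
        (fun l hl => by
          rw [huA l hl fun hlp => hl (hlp ▸ hp), mul_zero, add_zero]
          exact hxA l hl)
        (fun j => mul_nonneg (hc j) (Real.exp_pos _).le) ⟨i, hiA, hi⟩
      refine ⟨ε, hε, ?_⟩
      convert hle using 2 with j _ j _
      · rw [mul_assoc, ← Real.exp_add, ← real_inner_smul_left, ← inner_add_left, ← huv]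
        congr 3
        rw [Finset.smul_sum, ← Finset.sum_add_distrib]
        refine Finset.sum_congr rfl fun l _ => ?_
        rw [smul_smul, ← add_smul]
        congr 1
        ring
      · rw [mul_assoc, ← Real.exp_add, hup, mul_one]
    obtain ⟨δ₂, hδ₂, hδ₂x, hδ₂i⟩ := exists_cube_exit x u hx ⟨p, by rw [hup]; exact one_ne_zero⟩
    obtain ⟨δ₁, hδ₁, hδ₁x, hδ₁i⟩ := exists_cube_exit x (-u) hx
      ⟨p, by rw [Pi.neg_apply, hup]; norm_num⟩
    simp only [Pi.neg_apply, mul_neg, ← neg_mul, ne_eq, neg_eq_zero] at hδ₁x hδ₁i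
    obtain ⟨ε₂, hε₂, hle₂⟩ := move δ₂ hδ₂x hδ₂i
    obtain ⟨ε₁, hε₁, hle₁⟩ := move (-δ₁) hδ₁x hδ₁i
    -- the potential is concave along the direction of the walk
    let H : ℝ → ℝ := ∑ j, fun y => (c j * Real.exp (walkExponent v A p (θ j) y +
      (y - x p) * inner ℝ w (θ j)))
    have hH : ConcaveOn ℝ (Set.Icc (-1) 1) H := by
      refine Finset.sum_induction _ (ConcaveOn ℝ (Set.Icc (-1) 1)) (fun _ _ h h' => h.add h')
        (concaveOn_const _ (convex_Icc _ _)) fun j _ => ?_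
      have h1 := (walkPotential.concaveOn
        (s := ‖v p‖ ^ 2 - ‖(spanOn v (A.erase p)).starProjection (v p)‖ ^ 2)
        ((walk_inner_sq_le hp (θ j)).trans (mul_le_of_le_one_left
          (walk_energy_nonneg (v := v) (A := A) (p := p) (θ j)) (walk_height_le_one hv)))).smul
        (mul_nonneg (hc j) (Real.exp_pos (25 * ‖(spanOn v (A.erase p)).starProjection (θ j)‖ ^ 2 -
          x p * inner ℝ w (θ j))).le)
      refine h1.congr fun y _ => ?_
      simp only [smul_eq_mul]
      rw [mul_assoc, ← Real.exp_add, walkExponent]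
      congr 2
      ring
    have hHy : ∀ δ, H (x p + δ) =
        ∑ j, c j * Real.exp (δ * inner ℝ w (θ j) + walkExponent v A p (θ j) (x p + δ)) := by
      intro δ
      simp only [H, Finset.sum_apply]
      refine Finset.sum_congr rfl fun j _ => ?_
      rw [add_comm, add_sub_cancel_left]
    have hHx : H (x p) = ∑ j, c j * Real.exp (walkExponent v A p (θ j) (x p)) := by
      simpa using hHy 0
    have hmin := hH.min_le_of_mem_Icc (x := x p + -δ₁) (y := x p + δ₂) (z := x p)
      (by have := abs_le.1 (hδ₁x p); rw [hup, mul_one] at this; exact this)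
      (by have := abs_le.1 (hδ₂x p); rw [hup, mul_one] at this; exact this)
      ⟨by linarith, by linarith⟩
    rw [← hHx]
    rcases min_le_iff.1 hmin with h | h
    · exact ⟨ε₁, hε₁, hle₁.trans ((hHy _).symm.le.trans h)⟩
    · exact ⟨ε₂, hε₂, hle₂.trans ((hHy _).symm.le.trans h)⟩

/-- **Subgaussian signings** (the Gram-Schmidt walk): vectors in the unit ball admit a signing whose
exponential moments, summed over finitely many directions, are subgaussian. -/
theorem exists_signs_subgaussian {v : ι → E} (hv : ∀ i, ‖v i‖ ≤ 1) (θ : J → E) :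
    ∃ ε : ι → ℝ, (∀ i, |ε i| = 1) ∧
      ∑ j, Real.exp (inner ℝ (∑ i, ε i • v i) (θ j)) ≤ ∑ j, Real.exp (25 * ‖θ j‖ ^ 2) := by
  rcases isEmpty_or_nonempty ι with h | ⟨⟨p⟩⟩
  · refine ⟨fun _ => 1, fun i => h.elim i, Finset.sum_le_sum fun j _ => Real.exp_le_exp.2 ?_⟩
    simp only [Finset.univ_eq_empty, Finset.sum_empty, inner_zero_left]
    positivity
  · obtain ⟨ε, hε, hle⟩ := exists_signs_walk hv θ _ Finset.univ p 0 (fun _ => 1) rfl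
      (Finset.mem_univ p) (by simp) (by simp) (by simp)
    simp only [Pi.zero_apply, sub_zero, one_mul] at hle
    refine ⟨ε, hε, hle.trans (Finset.sum_le_sum fun j _ => Real.exp_le_exp.2 ?_)⟩
    refine (walkExponent_le hv (Finset.mem_univ p) (θ j) (by simp)).trans ?_
    have := pow_le_pow_left₀ (norm_nonneg _)
      (Submodule.norm_starProjection_apply_le (spanOn v Finset.univ) (θ j)) 2
    linarith

end GramSchmidtWalk

/-! ### Factorizing the incidence matrix of arithmetic progressions. -/

section ArithmeticProgressions

lemma AP_exists_parameters {n : ℕ} {S : Finset (Finset.Icc 1 n)} (hS : S ∈ DiscAP.AP n) :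
    ∃ a δ l : ℕ, 1 ≤ a ∧ 1 ≤ δ ∧ δ ≤ n ∧ 1 ≤ l ∧ a + l * δ ≤ n + δ ∧
      ∀ x : Finset.Icc 1 n, x ∈ S ↔ ∃ i < l, (x : ℕ) = a + i * δ := by
  simp only [DiscAP.AP, Finset.mem_filter, Finset.mem_univ, true_and] at hS
  obtain ⟨a, δ, l, hδ, hl, hS⟩ := hS
  have hmem : ∀ x : Finset.Icc 1 n, x ∈ S ↔ ∃ i < l, (x : ℕ) = a + i * δ := by
    intro x
    have := Set.ext_iff.1 hS x
    simpa using this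
  have hrange : ∀ i < l, 1 ≤ a + i * δ ∧ a + i * δ ≤ n := by
    intro i hi
    have : a + i * δ ∈ Subtype.val '' (S : Set (Finset.Icc 1 n)) := by
      rw [hS]; exact ⟨i, hi, rfl⟩
    obtain ⟨y, -, hy⟩ := this
    rw [← hy]
    exact Finset.mem_Icc.1 y.2
  have ha := hrange 0 hl
  simp only [zero_mul, add_zero] at ha
  by_cases hδn : δ ≤ n
  · refine ⟨a, δ, l, ha.1, hδ, hδn, hl, ?_, hmem⟩
    have h1 := (hrange (l - 1) (by omega)).2
    obtain ⟨m, rfl⟩ : ∃ m, l = m + 1 := ⟨l - 1, by omega⟩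
    rw [Nat.add_sub_cancel] at h1
    nlinarith
  -- A difference exceeding `n` forces a single point, for which the difference may be taken to be
  -- `1`.
  · have hl1 : l = 1 := by
      by_contra h
      have := (hrange 1 (by omega)).2
      omega
    subst hl1
    refine ⟨a, 1, 1, ha.1, le_rfl, by omega, le_rfl, by omega, fun x => (hmem x).trans ?_⟩
    simp

lemma card_AP_le (n : ℕ) : (DiscAP.AP n).card ≤ (n + 1) ^ 3 := by
  classical
  let F : ℕ × ℕ × ℕ → Finset (Finset.Icc 1 n) := fun p =>
    Finset.univ.filter fun x => ∃ i < p.2.2, (x : ℕ) = p.1 + i * p.2.1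
  have : DiscAP.AP n ⊆ (Finset.range (n + 1) ×ˢ Finset.range (n + 1) ×ˢ Finset.range (n + 1)).image F := by
    intro S hS
    obtain ⟨a, δ, l, ha, hδ, hδn, hl, hal, hmem⟩ := AP_exists_parameters hS
    obtain ⟨m, rfl⟩ : ∃ m, l = m + 1 := ⟨l - 1, by omega⟩
    have hm : m ≤ m * δ := Nat.le_mul_of_pos_right _ hδ
    have hal' : a + m * δ ≤ n := by
      rw [add_mul] at hal; omega
    refine Finset.mem_image.2 ⟨(a, δ, m + 1), ?_, ?_⟩
    · simp only [Finset.mem_product, Finset.mem_range]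
      omega
    · ext x
      simp [F, hmem]
  calc _ ≤ _ := Finset.card_le_card this
    _ ≤ _ := Finset.card_image_le
    _ = _ := by simp [Finset.card_product]; ring

/-- Weight of the dyadic blocks of length `s * 2 ^ k`. -/
noncomputable def blockWeight (s k : ℕ) : ℝ := √((3 / 2) ^ k / s)

lemma blockWeight_sq (s k : ℕ) : blockWeight s k ^ 2 = (3 / 2) ^ k / s :=
  Real.sq_sqrt (by positivity)

lemma blockWeight_pos {s : ℕ} (hs : 0 < s) (k : ℕ) : 0 < blockWeight s k :=
  Real.sqrt_pos.2 (div_pos (by positivity) (by exact_mod_cast hs))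

/-- Coordinates: single points, and blocks of length `s * 2 ^ k` in the residue classes. -/
abbrev BlockIndex (n : ℕ) : Type :=
  Fin (n + 1) ⊕ (Fin (n + 1) × Fin (n + 1) × Fin (n + 1) × Fin (n + 1))

/-- The vector of the point `x`. -/
noncomputable def pointVec (n s x : ℕ) : BlockIndex n → ℝ
  | .inl y => if (y : ℕ) = x then 1 else 0
  | .inr (k, δ, r, j) =>
    if (1 ≤ (δ : ℕ) ∧ (δ : ℕ) * (s * 2 ^ (k : ℕ)) ≤ 2 * n) ∧ x % δ = r ∧
      x / δ / (s * 2 ^ (k : ℕ)) = j then blockWeight s k else 0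

/-- The vector of the initial segment `{x : x % δ = r, x / δ < v}` of a residue class. -/
noncomputable def prefixVec (n s δ r v : ℕ) : BlockIndex n → ℝ
  | .inl y => if (y : ℕ) % δ = r ∧ (y : ℕ) / δ / s = v / s ∧ (y : ℕ) / δ < v then 1 else 0
  | .inr (k, δ', r', j) =>
    if ((δ' : ℕ) = δ ∧ (r' : ℕ) = r) ∧ (j : ℕ) + 1 = v / (s * 2 ^ (k : ℕ)) ∧
      v / (s * 2 ^ (k : ℕ)) % 2 = 1 then (blockWeight s k)⁻¹ else 0

/-- If the block of `q` precedes that of `v`, either there is exactly one level below `K` at which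
the two are left and right halves of the same parent, or they still differ at level `K`. -/
lemma dyadic_telescope (s q v K : ℕ) :
    (if q / s < v / s then (1 : ℝ) else 0) =
      (∑ k ∈ Finset.range K, if q / (s * 2 ^ k) + 1 = v / (s * 2 ^ k) ∧ v / (s * 2 ^ k) % 2 = 1
        then (1 : ℝ) else 0) + if q / (s * 2 ^ K) < v / (s * 2 ^ K) then 1 else 0 := by
  induction K with
  | zero => simp
  | succ K ih =>
    rw [ih, Finset.sum_range_succ, add_assoc]
    congr 1
    rw [pow_succ, ← mul_assoc, ← Nat.div_div_eq_div_mul q (s * 2 ^ K),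
      ← Nat.div_div_eq_div_mul v (s * 2 ^ K)]
    generalize q / (s * 2 ^ K) = p
    generalize v / (s * 2 ^ K) = m
    by_cases h1 : p + 1 = m ∧ m % 2 = 1
    · rw [if_pos h1, if_pos (by omega), if_neg (by omega), add_zero]
    · rw [if_neg h1, zero_add]
      by_cases h2 : p < m
      · rw [if_pos h2, if_pos (by omega)]
      · rw [if_neg h2, if_neg (by omega)]

lemma sum_prefixVec_mul_pointVec {n s δ r v x : ℕ} (hs : 0 < s) (hδ : 1 ≤ δ) (hδn : δ ≤ n)
    (hv : v * δ ≤ 2 * n) (hx : x ≤ n) :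
    ∑ t, prefixVec n s δ r v t * pointVec n s x t =
      if x % δ = r ∧ x / δ < v then 1 else 0 := by
  have hv2 : v ≤ 2 * n := (Nat.le_mul_of_pos_right v hδ).trans hv
  -- At level `n + 1` a block is longer than `v`, so the last term of the telescope vanishes.
  have hK : v / (s * 2 ^ (n + 1)) = 0 := by
    refine Nat.div_eq_of_lt ?_
    have h1 : n + 1 ≤ 2 ^ n := Nat.lt_two_pow_self
    have h2 : 2 ^ (n + 1) ≤ s * 2 ^ (n + 1) := Nat.le_mul_of_pos_left _ hs
    rw [pow_succ] at h2 ⊢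
    omega
  have hblock : ∀ k : Fin (n + 1), ∑ p : Fin (n + 1) × Fin (n + 1) × Fin (n + 1),
      prefixVec n s δ r v (.inr (k, p)) * pointVec n s x (.inr (k, p)) =
      if x % δ = r then (if x / δ / (s * 2 ^ (k : ℕ)) + 1 = v / (s * 2 ^ (k : ℕ)) ∧
        v / (s * 2 ^ (k : ℕ)) % 2 = 1 then 1 else 0) else 0 := by
    intro k
    have hxδ : x % δ < n + 1 := lt_of_le_of_lt (Nat.mod_le _ _) (by omega)
    have hxj : x / δ / (s * 2 ^ (k : ℕ)) < n + 1 :=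
      lt_of_le_of_lt ((Nat.div_le_self _ _).trans (Nat.div_le_self _ _)) (by omega)
    rw [Finset.sum_eq_single (⟨δ, by omega⟩, ⟨x % δ, hxδ⟩, ⟨x / δ / (s * 2 ^ (k : ℕ)), hxj⟩)]
    · simp only [prefixVec, pointVec, true_and, and_true]
      by_cases h1 : x % δ = r
      · by_cases h2 : x / δ / (s * 2 ^ (k : ℕ)) + 1 = v / (s * 2 ^ (k : ℕ)) ∧
          v / (s * 2 ^ (k : ℕ)) % 2 = 1
        · have h3 : s * 2 ^ (k : ℕ) ≤ v := by
            by_contra h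
            rw [Nat.div_eq_of_lt (not_le.1 h)] at h2
            omega
          have h4 : δ * (s * 2 ^ (k : ℕ)) ≤ 2 * n := by
            calc _ ≤ δ * v := Nat.mul_le_mul_left _ h3
              _ ≤ _ := by rwa [mul_comm]
          rw [if_pos ⟨h1, h2⟩, if_pos ⟨hδ, h4⟩, if_pos h1, if_pos h2,
            inv_mul_cancel₀ (blockWeight_pos hs _).ne']
        · rw [if_neg (fun h => h2 h.2), zero_mul, if_pos h1, if_neg h2]
      · rw [if_neg (fun h => h1 h.1), zero_mul, if_neg h1]
    · rintro ⟨δ', r', j⟩ - hne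
      simp only [prefixVec, pointVec]
      by_contra h
      have h1 := left_ne_zero_of_mul h
      have h2 := right_ne_zero_of_mul h
      simp only [ne_eq, ite_eq_right_iff, not_forall] at h1 h2
      obtain ⟨⟨⟨h3, -⟩, -⟩, -⟩ := h1
      obtain ⟨⟨-, h4, h5⟩, -⟩ := h2
      refine hne ?_
      rw [h3] at h4 h5
      simp [Prod.ext_iff, Fin.ext_iff, h3, h4, h5]
    · simp
  have hpoint : ∑ y : Fin (n + 1), prefixVec n s δ r v (.inl y) * pointVec n s x (.inl y) =
      if x % δ = r ∧ x / δ / s = v / s ∧ x / δ < v then 1 else 0 := by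
    rw [Finset.sum_eq_single ⟨x, by omega⟩]
    · simp [prefixVec, pointVec]
    · intro y _ hy
      have : (y : ℕ) ≠ x := fun h => hy (Fin.ext h)
      simp [pointVec, this]
    · simp
  rw [Fintype.sum_sum_type, hpoint, Fintype.sum_prod_type]
  simp_rw [hblock]
  by_cases hr : x % δ = r
  · simp only [hr, if_true, true_and]
    have := dyadic_telescope s (x / δ) v (n + 1)
    rw [hK, if_neg (Nat.not_lt_zero _), add_zero, ← Fin.sum_univ_eq_sum_range
      (fun k => if x / δ / (s * 2 ^ k) + 1 = v / (s * 2 ^ k) ∧ v / (s * 2 ^ k) % 2 = 1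
        then (1 : ℝ) else 0)] at this
    rw [← this]
    by_cases h1 : x / δ / s = v / s
    · rw [if_neg (by omega : ¬ x / δ / s < v / s), add_zero]
      simp [h1]
    · rw [if_neg (fun h => h1 h.1), zero_add]
      by_cases h2 : x / δ < v
      · have := Nat.div_le_div_right (c := s) h2.le
        rw [if_pos (by omega), if_pos h2]
      · have := Nat.div_le_div_right (c := s) (not_lt.1 h2)
        rw [if_neg (by omega), if_neg h2]
  · simp [hr]

lemma sum_pow_range_le {q : ℝ} (hq : 0 ≤ q) (hq1 : q < 1) (m : ℕ) :
    ∑ k ∈ Finset.range m, q ^ k ≤ (1 - q)⁻¹ := by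
  rw [← tsum_geometric_of_lt_one hq hq1]
  exact (summable_geometric_of_lt_one hq hq1).sum_le_tsum _ fun _ _ => pow_nonneg hq _

/-- At most `s` single points occur, and each level contributes at most one block, of squared
inverse weight `s * (2 / 3) ^ k`; the sum is at most `s + 3 * s`. -/
lemma sum_prefixVec_sq_le {n s δ r v : ℕ} (hs : 0 < s) :
    ∑ t, prefixVec n s δ r v t ^ 2 ≤ 4 * s := by
  have hpoint : ∑ y : Fin (n + 1), prefixVec n s δ r v (.inl y) ^ 2 ≤ s := by
    simp only [prefixVec, ite_pow, one_pow, zero_pow two_ne_zero, Finset.sum_boole]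
    have : (Finset.univ.filter fun y : Fin (n + 1) =>
        (y : ℕ) % δ = r ∧ (y : ℕ) / δ / s = v / s ∧ (y : ℕ) / δ < v).card ≤
        (Finset.Ico (s * (v / s)) (s * (v / s) + s)).card := by
      refine Finset.card_le_card_of_injOn (fun y => (y : ℕ) / δ) ?_ ?_
      · intro y hy
        obtain ⟨-, h1, -⟩ := (Finset.mem_filter.1 hy).2
        rw [Finset.mem_coe, Finset.mem_Ico, ← h1]
        exact ⟨Nat.mul_div_le _ _, by
          simpa [mul_add] using Nat.lt_mul_div_succ ((y : ℕ) / δ) hs⟩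
      · intro y hy z hz hyz
        have h1 := (Finset.mem_filter.1 hy).2.1
        have h2 := (Finset.mem_filter.1 hz).2.1
        refine Fin.ext ?_
        rw [← Nat.div_add_mod (y : ℕ) δ, ← Nat.div_add_mod (z : ℕ) δ, h1, h2]
        exact congrArg (fun t => δ * t + r) hyz
    rw [Nat.card_Ico, Nat.add_sub_cancel_left] at this
    exact_mod_cast this
  have hblock : ∀ k : Fin (n + 1), ∑ p : Fin (n + 1) × Fin (n + 1) × Fin (n + 1),
      prefixVec n s δ r v (.inr (k, p)) ^ 2 ≤ s * (2 / 3) ^ (k : ℕ) := by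
    intro k
    have hpos : (0 : ℝ) ≤ s * (2 / 3) ^ (k : ℕ) := by positivity
    by_cases hex : ∃ p₀ : Fin (n + 1) × Fin (n + 1) × Fin (n + 1),
        prefixVec n s δ r v (.inr (k, p₀)) ≠ 0
    · obtain ⟨⟨δ₀, r₀, j₀⟩, hp₀⟩ := hex
      simp only [prefixVec, ne_eq, ite_eq_right_iff, not_forall] at hp₀
      obtain ⟨⟨⟨h1, h2⟩, h3, h4⟩, -⟩ := hp₀
      rw [Finset.sum_eq_single (δ₀, r₀, j₀)]
      · simp only [prefixVec]
        rw [if_pos ⟨⟨h1, h2⟩, h3, h4⟩, inv_pow, blockWeight_sq, inv_div, div_eq_mul_inv, ← inv_pow]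
        norm_num
      · rintro ⟨δ', r', j⟩ - hne
        simp only [prefixVec]
        rw [if_neg, zero_pow two_ne_zero]
        rintro ⟨⟨h5, h6⟩, h7, -⟩
        refine hne ?_
        simp only [Prod.mk.injEq, Fin.ext_iff]
        omega
      · simp
    · push Not at hex
      simpa [hex] using hpos
  rw [Fintype.sum_sum_type, Fintype.sum_prod_type (f := fun p : Fin (n + 1) ×
    Fin (n + 1) × Fin (n + 1) × Fin (n + 1) => prefixVec n s δ r v (.inr p) ^ 2)]
  have h1 := Finset.sum_le_sum fun k (_ : k ∈ Finset.univ) => hblock k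
  rw [Fin.sum_univ_eq_sum_range (fun k => (s : ℝ) * (2 / 3) ^ k), ← Finset.mul_sum] at h1
  have h2 := mul_le_mul_of_nonneg_left
    (sum_pow_range_le (by norm_num : (0 : ℝ) ≤ 2 / 3) (by norm_num) (n + 1))
    (Nat.cast_nonneg (α := ℝ) s)
  norm_num at h2
  linarith

lemma sum_pointVec_sq_le {n s x : ℕ} (hns : n ≤ s ^ 2) (hs : 0 < s) :
    ∑ t, pointVec n s x t ^ 2 ≤ 3 ^ 2 := by
  have hs' : (0 : ℝ) < s := by exact_mod_cast hs
  have hpoint : ∑ y : Fin (n + 1), pointVec n s x (.inl y) ^ 2 ≤ 1 := by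
    simp only [pointVec, ite_pow, one_pow, zero_pow two_ne_zero, Finset.sum_boole]
    norm_cast
    refine Finset.card_le_one.2 fun y hy z hz => Fin.ext ?_
    rw [(Finset.mem_filter.1 hy).2, (Finset.mem_filter.1 hz).2]
  have hinner : ∀ k δ : Fin (n + 1), ∑ p : Fin (n + 1) × Fin (n + 1),
      pointVec n s x (.inr (k, δ, p)) ^ 2 ≤
      if 1 ≤ (δ : ℕ) ∧ (δ : ℕ) * (s * 2 ^ (k : ℕ)) ≤ 2 * n then blockWeight s k ^ 2 else 0 := by
    intro k δ
    simp only [pointVec]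
    split_ifs with h
    · simp only [h, true_and, and_self, ite_pow, zero_pow two_ne_zero]
      rw [← Finset.sum_filter, Finset.sum_const, nsmul_eq_mul]
      refine mul_le_of_le_one_left (sq_nonneg _) ?_
      norm_cast
      refine Finset.card_le_one.2 fun p hp q hq => ?_
      have h1 := (Finset.mem_filter.1 hp).2
      have h2 := (Finset.mem_filter.1 hq).2
      simp only [Prod.ext_iff, Fin.ext_iff]
      omega
    · simp [h]
  have hblock : ∀ k : Fin (n + 1), ∑ p : Fin (n + 1) × Fin (n + 1) × Fin (n + 1),
      pointVec n s x (.inr (k, p)) ^ 2 ≤ 2 * (3 / 4) ^ (k : ℕ) := by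
    intro k
    rw [Fintype.sum_prod_type]
    refine (Finset.sum_le_sum fun δ _ => hinner k δ).trans ?_
    rw [← Finset.sum_filter, Finset.sum_const, nsmul_eq_mul, blockWeight_sq]
    have hcard : (Finset.univ.filter fun δ : Fin (n + 1) =>
        1 ≤ (δ : ℕ) ∧ (δ : ℕ) * (s * 2 ^ (k : ℕ)) ≤ 2 * n).card ≤ 2 * n / (s * 2 ^ (k : ℕ)) := by
      rw [← Nat.add_sub_cancel (2 * n / (s * 2 ^ (k : ℕ))) 1, ← Nat.card_Icc]
      refine Finset.card_le_card_of_injOn (fun δ => (δ : ℕ)) ?_ ?_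
      · intro δ hδ
        obtain ⟨h1, h2⟩ := (Finset.mem_filter.1 hδ).2
        exact Finset.mem_coe.2 (Finset.mem_Icc.2 ⟨h1, (Nat.le_div_iff_mul_le (by positivity)).2 h2⟩)
      · exact fun _ _ _ _ h => Fin.ext h
    have hcard' : ((Finset.univ.filter fun δ : Fin (n + 1) =>
        1 ≤ (δ : ℕ) ∧ (δ : ℕ) * (s * 2 ^ (k : ℕ)) ≤ 2 * n).card : ℝ) ≤
        2 * s ^ 2 / (s * 2 ^ (k : ℕ)) := by
      refine (Nat.cast_le.2 hcard).trans (Nat.cast_div_le.trans ?_)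
      push_cast
      gcongr
      exact_mod_cast hns
    refine (mul_le_mul_of_nonneg_right hcard' (by positivity)).trans (le_of_eq ?_)
    rw [show (3 / 4 : ℝ) = 3 / 2 / 2 by norm_num, div_pow (3 / 2 : ℝ) 2]
    field_simp
  rw [Fintype.sum_sum_type, Fintype.sum_prod_type (f := fun p : Fin (n + 1) ×
    Fin (n + 1) × Fin (n + 1) × Fin (n + 1) => pointVec n s x (.inr p) ^ 2)]
  have h1 := Finset.sum_le_sum fun k (_ : k ∈ Finset.univ) => hblock k
  rw [Fin.sum_univ_eq_sum_range (fun k => (2 : ℝ) * (3 / 4) ^ k), ← Finset.mul_sum] at h1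
  have h2 := sum_pow_range_le (by norm_num : (0 : ℝ) ≤ 3 / 4) (by norm_num) (n + 1)
  norm_num at h2
  linarith

/-- The incidence matrix of arithmetic progressions has a factorization of size `O(n ^ (1 / 4))`. -/
theorem hasFactorization_AP {n : ℕ} (hn : 1 ≤ n) :
    HasFactorization (DiscAP.incidence (DiscAP.AP n)) (6 * (n : ℝ) ^ (1 / 4 : ℝ)) 3 := by
  set s := Nat.sqrt n + 1 with hs_def
  have hs : 0 < s := Nat.succ_pos _
  have hns : n ≤ s ^ 2 := by rw [sq]; exact (Nat.lt_succ_sqrt n).le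
  have hn' : (1 : ℝ) ≤ n := by exact_mod_cast hn
  -- The difference of two prefix vectors has squared norm at most `2 * 4 * s + 2 * 4 * s`, and `s ≤
  -- 2 * √n`.
  have hsn : 16 * (s : ℝ) ≤ (6 * (n : ℝ) ^ (1 / 4 : ℝ)) ^ 2 := by
    have h1 : ((n : ℝ) ^ (1 / 4 : ℝ)) ^ 2 = √n := by
      rw [Real.sqrt_eq_rpow, ← Real.rpow_natCast, ← Real.rpow_mul (by positivity)]
      norm_num
    have h2 : (Nat.sqrt n : ℝ) ≤ √n := Real.nat_sqrt_le_real_sqrt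
    have h3 : 1 ≤ √(n : ℝ) := Real.one_le_sqrt.2 hn'
    rw [mul_pow, h1, hs_def]
    push_cast
    linarith
  choose a δ l ha hδ hδn hl hal hmem using fun S : DiscAP.AP n => AP_exists_parameters S.2
  refine HasFactorization.of_fintype (ι := BlockIndex n)
    (fun S t => prefixVec n s (δ S) (a S % δ S) (a S / δ S + l S) t -
      prefixVec n s (δ S) (a S % δ S) (a S / δ S) t)
    (fun x t => pointVec n s x t) (by positivity) (by norm_num) ?_ ?_
    (fun x => sum_pointVec_sq_le hns hs)
  · intro S x
    have hx := (Finset.mem_Icc.1 x.2).2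
    have h1 : a S / δ S * δ S ≤ a S := Nat.div_mul_le_self _ _
    have h2 : (a S / δ S + l S) * δ S ≤ 2 * n := by
      rw [add_mul]
      have := hal S
      have := hδn S
      omega
    have h3 : a S / δ S * δ S ≤ 2 * n := by
      refine le_trans ?_ h2
      exact Nat.mul_le_mul_right _ (Nat.le_add_right _ _)
    simp_rw [sub_mul]
    rw [Finset.sum_sub_distrib, sum_prefixVec_mul_pointVec hs (hδ S) (hδn S) h2 hx,
      sum_prefixVec_mul_pointVec hs (hδ S) (hδn S) h3 hx, DiscAP.incidence]
    have hiff : x ∈ S.1 ↔ ((x : ℕ) % δ S = a S % δ S ∧ (x : ℕ) / δ S < a S / δ S + l S) ∧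
        ¬ ((x : ℕ) % δ S = a S % δ S ∧ (x : ℕ) / δ S < a S / δ S) := by
      rw [hmem]
      constructor
      · rintro ⟨i, hi, hxi⟩
        rw [hxi, Nat.add_mul_mod_self_right, Nat.add_mul_div_right _ _ (hδ S)]
        omega
      · rintro ⟨⟨h4, h5⟩, h6⟩
        have h7 : a S / δ S ≤ x / δ S := by
          by_contra h
          exact h6 ⟨h4, not_le.1 h⟩
        refine ⟨x / δ S - a S / δ S, by omega, ?_⟩
        have h8 := Nat.div_add_mod (x : ℕ) (δ S)
        have h9 := Nat.div_add_mod (a S) (δ S)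
        obtain ⟨i, hi⟩ := Nat.exists_eq_add_of_le h7
        rw [hi, Nat.add_sub_cancel_left]
        rw [hi, h4] at h8
        nlinarith
    by_cases h4 : (x : ℕ) % δ S = a S % δ S ∧ (x : ℕ) / δ S < a S / δ S
    · rw [if_pos h4, if_pos ⟨h4.1, by omega⟩, if_neg (fun h => (hiff.1 h).2 h4), sub_self]
    · rw [if_neg h4, sub_zero]
      exact if_congr (by tauto) rfl rfl
  · intro S
    refine le_trans ?_ hsn
    calc _ ≤ ∑ t, ((2 : ℝ) * prefixVec n s (δ S) (a S % δ S) (a S / δ S + l S) t ^ 2 +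
          2 * prefixVec n s (δ S) (a S % δ S) (a S / δ S) t ^ 2) := by
          refine Finset.sum_le_sum fun t _ => ?_
          nlinarith [sq_nonneg (prefixVec n s (δ S) (a S % δ S) (a S / δ S + l S) t +
            prefixVec n s (δ S) (a S % δ S) (a S / δ S) t)]
      _ ≤ 16 * (s : ℝ) := by
          rw [Finset.sum_add_distrib, ← Finset.mul_sum, ← Finset.mul_sum]
          have h1 := sum_prefixVec_sq_le (n := n) (δ := δ S) (r := a S % δ S)
            (v := a S / δ S + l S) hs
          have h2 := sum_prefixVec_sq_le (n := n) (δ := δ S) (r := a S % δ S)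
            (v := a S / δ S) hs
          linarith

end ArithmeticProgressions

/-! ### Roth's Fourier-analytic lower bound. -/

section LowerBound

open Complex in
lemma sum_norm_dft_sq {N : ℕ} (hN : N ≠ 0) (g : ℕ → ℝ) :
    ∑ k ∈ Finset.range N, ‖∑ x ∈ Finset.range N, (g x : ℂ) * exp (2 * Real.pi * I / N) ^ (k * x)‖ ^ 2 =
      N * ∑ x ∈ Finset.range N, g x ^ 2 := by
  set ζ := exp (2 * Real.pi * I / N) with hζdef
  have hζ : IsPrimitiveRoot ζ N := Complex.isPrimitiveRoot_exp N hN
  have hζ0 : ζ ≠ 0 := hζ.ne_zero hN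
  have hconj : (starRingEnd ℂ) ζ = ζ⁻¹ := by
    rw [Complex.inv_eq_conj (hζ.norm'_eq_one hN)]
  have horth : ∀ x ∈ Finset.range N, ∀ y ∈ Finset.range N,
      ∑ k ∈ Finset.range N, ζ ^ (k * x) * (ζ⁻¹) ^ (k * y) = if x = y then (N : ℂ) else 0 := by
    intro x hx y hy
    have : ∀ k, ζ ^ (k * x) * (ζ⁻¹) ^ (k * y) = (ζ ^ x * (ζ⁻¹) ^ y) ^ k := fun k => by
      rw [mul_pow, ← pow_mul, ← pow_mul, mul_comm x, mul_comm y]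
    simp_rw [this]
    split_ifs with h
    · subst h
      rw [← mul_pow, mul_inv_cancel₀ hζ0]
      simp
    · have hne : ζ ^ x * (ζ⁻¹) ^ y ≠ 1 := by
        intro h1
        rw [inv_pow, mul_inv_eq_one₀ (pow_ne_zero _ hζ0)] at h1
        exact h (hζ.pow_inj (Finset.mem_range.1 hx) (Finset.mem_range.1 hy) h1)
      have h1 : (ζ ^ x * (ζ⁻¹) ^ y) ^ N = 1 := by
        rw [mul_pow, ← pow_mul, ← pow_mul, mul_comm x, mul_comm y, pow_mul, pow_mul, inv_pow,
          hζ.pow_eq_one]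
        simp
      have h2 := geom_sum_mul (ζ ^ x * (ζ⁻¹) ^ y) N
      rw [h1, sub_self] at h2
      exact (mul_eq_zero.1 h2).resolve_right (sub_ne_zero.2 hne)
  have key : ∀ k, ((‖∑ x ∈ Finset.range N, (g x : ℂ) * ζ ^ (k * x)‖ ^ 2 : ℝ) : ℂ) =
      ∑ x ∈ Finset.range N, ∑ y ∈ Finset.range N,
        (g x * g y : ℂ) * (ζ ^ (k * x) * (ζ⁻¹) ^ (k * y)) := by
    intro k
    push_cast
    rw [← Complex.mul_conj', map_sum, Finset.sum_mul_sum]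
    refine Finset.sum_congr rfl fun x _ => Finset.sum_congr rfl fun y _ => ?_
    rw [map_mul, map_pow, hconj, Complex.conj_ofReal]
    ring
  have : ((∑ k ∈ Finset.range N, ‖∑ x ∈ Finset.range N, (g x : ℂ) * ζ ^ (k * x)‖ ^ 2 : ℝ) : ℂ) =
      ((N * ∑ x ∈ Finset.range N, g x ^ 2 : ℝ) : ℂ) := by
    rw [Complex.ofReal_sum]
    simp_rw [key]
    rw [Finset.sum_comm]
    push_cast
    rw [Finset.mul_sum]
    refine Finset.sum_congr rfl fun x hx => ?_
    rw [Finset.sum_comm]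
    simp_rw [← Finset.mul_sum]
    rw [Finset.sum_congr rfl fun y hy => by rw [horth x hx y hy], Finset.sum_eq_single x]
    · rw [if_pos rfl]; ring
    · intro y _ hy
      rw [if_neg hy.symm, mul_zero]
    · exact fun h => absurd hx h
  exact_mod_cast this

open Complex in
/-- By Dirichlet's theorem every frequency has a multiple at which short progressions are far from
cancelling. -/
lemma exists_norm_geom_sum_ge (N k : ℕ) {D L : ℕ} (hD : 0 < D) (hL : 13 * (L - 1) ≤ D) :
    ∃ δ ∈ Finset.Icc 1 D,
      (L : ℝ) / 2 ≤ ‖∑ i ∈ Finset.range L, exp (2 * Real.pi * I / N) ^ (k * (i * δ))‖ := by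
  obtain ⟨δ, hδ0, hδD, hδ⟩ := Real.exists_nat_abs_mul_sub_round_le ((k : ℝ) / N) hD
  refine ⟨δ, Finset.mem_Icc.2 ⟨hδ0, hδD⟩, ?_⟩
  set m := round ((δ : ℝ) * ((k : ℝ) / N)) with hm
  set t : ℝ := (δ : ℝ) * ((k : ℝ) / N) - m with ht
  have hpow : ∀ i : ℕ, exp (2 * Real.pi * I / N) ^ (k * (i * δ)) =
      exp (I * ((2 * Real.pi * t * i : ℝ) : ℂ)) := by
    intro i
    rw [← Complex.exp_nat_mul, Complex.exp_eq_exp_iff_exists_int]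
    refine ⟨m * i, ?_⟩
    rw [ht]
    push_cast
    ring
  have hbound : ∀ i ∈ Finset.range L,
      ‖exp (2 * Real.pi * I / N) ^ (k * (i * δ)) - 1‖ ≤ 1 / 2 := by
    intro i hi
    rw [hpow]
    refine (Real.norm_exp_I_mul_ofReal_sub_one_le).trans ?_
    have hi' : 13 * i ≤ D := by
      have := Finset.mem_range.1 hi
      omega
    have hi'' : 13 * (i : ℝ) ≤ D := by exact_mod_cast hi'
    have hDpos : (0 : ℝ) < D + 1 := by positivity
    rw [Real.norm_eq_abs, abs_mul, abs_mul, abs_of_pos Real.two_pi_pos, Nat.abs_cast]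
    -- The phases are at most `2π / 13 < 1 / 2`, whence the constant `13`.
    have h1 : |t| * i ≤ 1 / 13 := by
      calc |t| * i ≤ 1 / (D + 1) * i := mul_le_mul_of_nonneg_right hδ (Nat.cast_nonneg _)
        _ ≤ 1 / 13 := by
          rw [one_div_mul_eq_div, div_le_div_iff₀ hDpos (by norm_num)]
          linarith
    have h2 := Real.pi_lt_d2
    have h3 : 0 ≤ |t| * i := by positivity
    nlinarith [Real.pi_pos]
  have h1 : ‖∑ i ∈ Finset.range L, (exp (2 * Real.pi * I / N) ^ (k * (i * δ)) - 1)‖ ≤ L / 2 := by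
    refine (norm_sum_le_of_le _ hbound).trans (le_of_eq ?_)
    simp; ring
  rw [Finset.sum_sub_distrib] at h1
  have h2 : ‖(∑ _i ∈ Finset.range L, (1 : ℂ))‖ = L := by simp
  have h3 := norm_sub_norm_le (∑ _i ∈ Finset.range L, (1 : ℂ))
    (∑ i ∈ Finset.range L, exp (2 * Real.pi * I / N) ^ (k * (i * δ)))
  rw [h2, norm_sub_rev] at h3
  linarith

open Complex in
-- For fixed `δ` the progression sums are a correlation of `g`, so their transform is that of `g`
-- times a geometric sum. Parseval in `a`, keeping for each frequency one `δ` with a large geometric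
-- sum, gives the bound. The zeros of `g` up to `M` and from `N` on make shifts by `i * δ ≤ M`
-- harmless.
lemma sum_progression_sums_sq_ge {N M D L : ℕ} (hD : 0 < D) (hL : 13 * (L - 1) ≤ D)
    (hM : L * D ≤ M) (hN : N ≠ 0) (g : ℕ → ℝ) (hgM : ∀ y ≤ M, g y = 0) (hgN : ∀ y, N ≤ y → g y = 0) :
    (L : ℝ) ^ 2 / 4 * ∑ y ∈ Finset.range N, g y ^ 2 ≤
      ∑ δ ∈ Finset.Icc 1 D, ∑ a ∈ Finset.range N, (∑ i ∈ Finset.range L, g (a + i * δ)) ^ 2 := by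
  set ζ := exp (2 * Real.pi * I / N) with hζdef
  have hζ : IsPrimitiveRoot ζ N := Complex.isPrimitiveRoot_exp N hN
  have hζ1 : ‖ζ‖ = 1 := hζ.norm'_eq_one hN
  have hshift : ∀ k i δ : ℕ, i < L → δ ≤ D →
      ∑ a ∈ Finset.range N, (g (a + i * δ) : ℂ) * ζ ^ (k * a) =
        (starRingEnd ℂ) (ζ ^ (k * (i * δ))) * ∑ y ∈ Finset.range N, (g y : ℂ) * ζ ^ (k * y) := by
    intro k i δ hi hδ
    have hiδ : i * δ ≤ M := (Nat.mul_le_mul hi.le hδ).trans hM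
    have h1 : ∑ a ∈ Finset.range N, (g (a + i * δ) : ℂ) * ζ ^ (k * (a + i * δ)) =
        ∑ y ∈ Finset.range N, (g y : ℂ) * ζ ^ (k * y) := by
      have h2 : ∑ y ∈ Finset.range (N + i * δ), (g y : ℂ) * ζ ^ (k * y) =
          ∑ y ∈ Finset.range N, (g y : ℂ) * ζ ^ (k * y) := by
        refine (Finset.sum_subset (Finset.range_subset_range.2 (Nat.le_add_right _ _))
          fun y _ hy => ?_).symm
        rw [hgN y (by simpa using hy)]; simp
      rw [← h2, add_comm N, Finset.sum_range_add, Finset.sum_eq_zero (s := Finset.range (i * δ)),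
        zero_add]
      · exact Finset.sum_congr rfl fun a _ => by rw [add_comm]
      · intro y hy
        rw [hgM y ((Finset.mem_range.1 hy).le.trans hiδ)]; simp
    rw [← h1, Finset.mul_sum]
    refine Finset.sum_congr rfl fun a _ => ?_
    rw [mul_add, pow_add]
    have h3 : (starRingEnd ℂ) (ζ ^ (k * (i * δ))) * ζ ^ (k * (i * δ)) = 1 := by
      rw [Complex.conj_mul', norm_pow, hζ1]; simp
    linear_combination (-(g (a + i * δ) : ℂ) * ζ ^ (k * a)) * h3
  have hdft : ∀ δ ≤ D, ∀ k, ‖∑ a ∈ Finset.range N,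
      ((∑ i ∈ Finset.range L, g (a + i * δ) : ℝ) : ℂ) * ζ ^ (k * a)‖ =
      ‖∑ i ∈ Finset.range L, ζ ^ (k * (i * δ))‖ *
        ‖∑ y ∈ Finset.range N, (g y : ℂ) * ζ ^ (k * y)‖ := by
    intro δ hδ k
    rw [← norm_conj (∑ i ∈ Finset.range L, _), ← norm_mul, map_sum, Finset.sum_mul]
    congr 1
    rw [← Finset.sum_congr rfl fun i hi => hshift k i δ (Finset.mem_range.1 hi) hδ,
      Finset.sum_comm]
    refine Finset.sum_congr rfl fun a _ => ?_
    rw [Complex.ofReal_sum, Finset.sum_mul]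
  have hN' : (0 : ℝ) < N := by exact_mod_cast Nat.pos_of_ne_zero hN
  refine le_of_mul_le_mul_left ?_ hN'
  calc (N : ℝ) * ((L : ℝ) ^ 2 / 4 * ∑ y ∈ Finset.range N, g y ^ 2)
      = ∑ k ∈ Finset.range N, ((L : ℝ) / 2) ^ 2 *
          ‖∑ y ∈ Finset.range N, (g y : ℂ) * ζ ^ (k * y)‖ ^ 2 := by
        rw [← Finset.mul_sum, sum_norm_dft_sq hN]; ring
    _ ≤ ∑ k ∈ Finset.range N, ∑ δ ∈ Finset.Icc 1 D, (‖∑ i ∈ Finset.range L, ζ ^ (k * (i * δ))‖ *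
          ‖∑ y ∈ Finset.range N, (g y : ℂ) * ζ ^ (k * y)‖) ^ 2 := by
        refine Finset.sum_le_sum fun k _ => ?_
        obtain ⟨δ, hδ, hle⟩ := exists_norm_geom_sum_ge N k hD hL
        refine le_trans ?_ (Finset.single_le_sum (fun _ _ => sq_nonneg _) hδ)
        rw [mul_pow]
        gcongr
    _ = ∑ δ ∈ Finset.Icc 1 D, ∑ k ∈ Finset.range N, ‖∑ a ∈ Finset.range N,
          ((∑ i ∈ Finset.range L, g (a + i * δ) : ℝ) : ℂ) * ζ ^ (k * a)‖ ^ 2 := by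
        rw [Finset.sum_comm]
        refine Finset.sum_congr rfl fun δ hδ => Finset.sum_congr rfl fun k _ => ?_
        rw [hdft δ (Finset.mem_Icc.1 hδ).2 k]
    _ = _ := by
        rw [Finset.mul_sum]
        exact Finset.sum_congr rfl fun δ _ => sum_norm_dft_sq hN _

/-- The part of the progression `a - M, a + δ - M, …` with `L` terms that lies in `[n]`. -/
def clippedProgression (n M L a δ : ℕ) : Finset (Finset.Icc 1 n) :=
  Finset.univ.filter fun x => ∃ i < L, (x : ℕ) + M = a + i * δ

lemma clippedProgression_mem_AP {n M L a δ : ℕ} (hδ : 1 ≤ δ)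
    (h : (clippedProgression n M L a δ).Nonempty) : clippedProgression n M L a δ ∈ DiscAP.AP n := by
  classical
  let I := (Finset.range L).filter fun i => ∃ x : Finset.Icc 1 n, (x : ℕ) + M = a + i * δ
  have hI : I.Nonempty := by
    obtain ⟨x, hx⟩ := h
    obtain ⟨i, hi, hxi⟩ := (Finset.mem_filter.1 hx).2
    exact ⟨i, Finset.mem_filter.2 ⟨Finset.mem_range.2 hi, x, hxi⟩⟩
  obtain ⟨hm1, x₀, hx₀⟩ := Finset.mem_filter.1 (I.min'_mem hI)
  obtain ⟨hM1, x₁, hx₁⟩ := Finset.mem_filter.1 (I.max'_mem hI)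
  have hmin : ∀ i ∈ I, I.min' hI ≤ i := fun i hi => I.min'_le i hi
  have hmax : ∀ i ∈ I, i ≤ I.max' hI := fun i hi => I.le_max' i hi
  have hle := I.min'_le_max' hI
  generalize I.min' hI = i₀ at *
  generalize I.max' hI = i₁ at *
  obtain ⟨l, rfl⟩ := Nat.exists_eq_add_of_le hle
  rw [Finset.mem_range] at hm1 hM1
  simp only [DiscAP.AP, Finset.mem_filter, Finset.mem_univ, true_and]
  refine ⟨x₀, δ, l + 1, hδ, by omega, ?_⟩
  have hx₀' := Finset.mem_Icc.1 x₀.2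
  have hx₁' := Finset.mem_Icc.1 x₁.2
  ext y
  simp only [Set.mem_image, Finset.mem_coe, Set.mem_ofPred_eq, clippedProgression,
    Finset.mem_filter, Finset.mem_univ, true_and]
  constructor
  · rintro ⟨x, ⟨i, hi, hxi⟩, rfl⟩
    have hiI : i ∈ I := Finset.mem_filter.2 ⟨Finset.mem_range.2 hi, x, hxi⟩
    have h1 := hmax i hiI
    obtain ⟨j, rfl⟩ := Nat.exists_eq_add_of_le (hmin i hiI)
    refine ⟨j, by omega, ?_⟩
    rw [add_mul] at hxi
    omega
  · rintro ⟨j, hj, rfl⟩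
    have h1 : j * δ ≤ l * δ := Nat.mul_le_mul_right _ (by omega)
    rw [add_mul] at hx₁
    refine ⟨⟨x₀ + j * δ, Finset.mem_Icc.2 ⟨by omega, by omega⟩⟩, ⟨i₀ + j, by omega, ?_⟩, rfl⟩
    rw [add_mul]
    simp only
    omega

/-- A family of arithmetic progressions whose incidence matrix is bounded below on `ℓ₂`. -/
lemma exists_AP_rows {n M N D L : ℕ} (hD : 0 < D) (hL : 13 * (L - 1) ≤ D)
    (hM : L * D ≤ M) (hN : M + n < N) :
    ∃ (m : Type) (_ : Fintype m) (S : m → DiscAP.AP n), Fintype.card m ≤ D * N ∧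
      ∀ f : Finset.Icc 1 n → ℝ, (L : ℝ) ^ 2 / 4 * ∑ x, f x ^ 2 ≤
        ∑ i, (((DiscAP.incidence (DiscAP.AP n)).submatrix S id) *ᵥ f) i ^ 2 := by
  classical
  let T : Finset (ℕ × ℕ) := (Finset.Icc 1 D ×ˢ Finset.range N).filter fun p =>
    (clippedProgression n M L p.2 p.1).Nonempty
  have hT : ∀ p : T, clippedProgression n M L p.1.2 p.1.1 ∈ DiscAP.AP n := fun p => by
    have := Finset.mem_filter.1 p.2
    exact clippedProgression_mem_AP (Finset.mem_Icc.1 (Finset.mem_product.1 this.1).1).1 this.2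
  refine ⟨T, inferInstance, fun p => ⟨_, hT p⟩, ?_, fun f => ?_⟩
  · rw [Fintype.card_coe]
    refine (Finset.card_filter_le _ _).trans ?_
    simp
  -- A copy of `f` translated by `M`, so that progressions starting left of `[n]` have natural
  -- starting points.
  let g : ℕ → ℝ := fun y => ∑ x : Finset.Icc 1 n, if (x : ℕ) + M = y then f x else 0
  have hx : ∀ x : Finset.Icc 1 n, 1 ≤ (x : ℕ) ∧ (x : ℕ) ≤ n := fun x => Finset.mem_Icc.1 x.2
  have hg : ∀ x : Finset.Icc 1 n, g (x + M) = f x := by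
    intro x
    simp only [g, add_left_inj]
    rw [Finset.sum_eq_single x]
    · simp
    · intro y _ hy
      rw [if_neg fun h => hy (Subtype.ext h)]
    · simp
  have hgM : ∀ y ≤ M, g y = 0 := fun y hy => Finset.sum_eq_zero fun x _ => by
    have := hx x
    rw [if_neg (by omega)]
  have hgN : ∀ y, N ≤ y → g y = 0 := fun y hy => Finset.sum_eq_zero fun x _ => by
    have := hx x
    rw [if_neg (by omega)]
  have hgsq : ∑ y ∈ Finset.range N, g y ^ 2 = ∑ x, f x ^ 2 := by
    have hinj : Function.Injective fun x : Finset.Icc 1 n => (x : ℕ) + M := fun x y h =>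
      Subtype.ext (by simpa using h)
    rw [← show ∑ x : Finset.Icc 1 n, g (x + M) ^ 2 = ∑ x, f x ^ 2 by simp_rw [hg],
      ← Finset.sum_image (f := fun y => g y ^ 2) (s := Finset.univ)
        (g := fun x : Finset.Icc 1 n => (x : ℕ) + M) hinj.injOn]
    refine (Finset.sum_subset ?_ ?_).symm
    · intro y hy
      obtain ⟨x, -, rfl⟩ := Finset.mem_image.1 hy
      have := hx x
      exact Finset.mem_range.2 (by omega)
    · intro y _ hy
      have : g y = 0 := Finset.sum_eq_zero fun x _ => if_neg fun h =>
        hy (Finset.mem_image.2 ⟨x, Finset.mem_univ _, h⟩)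
      rw [this]; simp
  have hrow : ∀ δ, 1 ≤ δ → ∀ a, ∑ i ∈ Finset.range L, g (a + i * δ) =
      ∑ x, if x ∈ clippedProgression n M L a δ then f x else 0 := by
    intro δ hδ a
    rw [Finset.sum_comm]
    refine Finset.sum_congr rfl fun x _ => ?_
    simp only [clippedProgression, Finset.mem_filter, Finset.mem_univ, true_and]
    split_ifs with h
    · obtain ⟨i, hi, hxi⟩ := h
      rw [Finset.sum_eq_single i]
      · rw [if_pos hxi]
      · intro j _ hj
        refine if_neg fun h => hj ?_
        exact Nat.eq_of_mul_eq_mul_right hδ (by omega)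
      · exact fun h => absurd (Finset.mem_range.2 hi) h
    · exact Finset.sum_eq_zero fun i hi => if_neg fun h' => h ⟨i, Finset.mem_range.1 hi, h'⟩
  have hmain := sum_progression_sums_sq_ge hD hL hM (by omega : N ≠ 0) g hgM hgN
  rw [hgsq] at hmain
  refine hmain.trans (le_of_eq ?_)
  rw [← Finset.sum_product' (f := fun δ a => (∑ i ∈ Finset.range L, g (a + i * δ)) ^ 2)]
  trans ∑ p ∈ T, (∑ x, if x ∈ clippedProgression n M L p.2 p.1 then f x else 0) ^ 2
  · rw [Finset.sum_filter]
    refine Finset.sum_congr rfl fun p hp => ?_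
    rw [hrow p.1 (Finset.mem_Icc.1 (Finset.mem_product.1 hp).1).1]
    split_ifs with h
    · rfl
    · rw [Finset.not_nonempty_iff_eq_empty.1 h]
      simp
  · rw [← Finset.sum_coe_sort]
    refine Finset.sum_congr rfl fun p _ => ?_
    simp [Matrix.mulVec, dotProduct, DiscAP.incidence]

end LowerBound

/-! ### Hereditary discrepancy from a factorization. -/

/-- The `γ₂` upper bound for hereditary discrepancy: a factorization of the incidence matrix of at
most `m` sets bounds the hereditary discrepancy by `O(β κ √log m)`. -/
theorem herdisc_le_of_hasFactorization {V : Type*} [Fintype V] [DecidableEq V]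
    {F : Finset (Finset V)} {β κ : ℝ} (hβ : 0 < β) (hκ : 0 < κ)
    (h : HasFactorization (DiscAP.incidence F) β κ) {m : ℕ} (hm : 1 ≤ m) (hFm : F.card ≤ m) :
    (DiscAP.herdisc F : ℝ) ≤ 26 * (β * κ) * √(Real.log (2 * m)) := by
  classical
  obtain ⟨k, b, c, hA, hb, hc⟩ := h
  have hm' : (1 : ℝ) ≤ m := by exact_mod_cast hm
  have hlog : 0 < Real.log (2 * m) := Real.log_pos (by linarith)
  set lam := √(Real.log (2 * m)) with hlam
  have hlam0 : 0 < lam := Real.sqrt_pos.2 hlog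
  have hlam2 : lam ^ 2 = Real.log (2 * m) := Real.sq_sqrt hlog.le
  have hB : 0 ≤ 26 * (β * κ) * lam := by positivity
  rw [← Nat.le_floor_iff hB]
  refine Finset.sup_le fun J _ => ?_
  let v : J → EuclideanSpace ℝ (Fin k) := fun x => κ⁻¹ • c x
  have hv : ∀ x, ‖v x‖ ≤ 1 := fun x => by
    rw [norm_smul, norm_inv, Real.norm_of_nonneg hκ.le, inv_mul_le_one₀ hκ]
    exact hc x
  let sgn : Bool → ℝ := fun t => if t then 1 else -1
  -- Both signs of each row are tested, giving at most `2 * m` directions of norm at most `lam`. As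
  -- `lam ^ 2 = log (2 * m)`, their number costs one further `lam ^ 2` in the exponent, turning `25`
  -- into `26`.
  let θ : F × Bool → EuclideanSpace ℝ (Fin k) := fun p => (sgn p.2 * (lam / β)) • b p.1
  have hθ : ∀ p, ‖θ p‖ ^ 2 ≤ lam ^ 2 := fun p => by
    refine pow_le_pow_left₀ (norm_nonneg _) ?_ 2
    have hs : |sgn p.2| = 1 := by
      simp only [sgn]
      split_ifs <;> simp
    rw [norm_smul, norm_mul, Real.norm_eq_abs, hs, one_mul, Real.norm_of_nonneg (by positivity),
      div_mul_eq_mul_div, div_le_iff₀ hβ]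
    exact mul_le_mul_of_nonneg_left (hb _) hlam0.le
  obtain ⟨ε, hε, hle⟩ := exists_signs_subgaussian hv θ
  have htotal : ∑ p, Real.exp (25 * ‖θ p‖ ^ 2) ≤ Real.exp (26 * lam ^ 2) := by
    calc ∑ p, Real.exp (25 * ‖θ p‖ ^ 2) ≤ ∑ _p : F × Bool, Real.exp (25 * lam ^ 2) :=
          Finset.sum_le_sum fun p _ => Real.exp_le_exp.2 (by linarith [hθ p])
      _ = (2 * F.card) * Real.exp (25 * lam ^ 2) := by
          simp [mul_comm]
      _ ≤ (2 * m) * Real.exp (25 * lam ^ 2) := by gcongr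
      _ = Real.exp (26 * lam ^ 2) := by
          rw [show 26 * lam ^ 2 = lam ^ 2 + 25 * lam ^ 2 by ring, Real.exp_add, hlam2,
            Real.exp_log (by linarith)]
  have hsign : ∀ (S : F) (t : Bool), sgn t * ∑ x : J, DiscAP.incidence F S x * ε x ≤
      26 * (β * κ) * lam := by
    intro S t
    have h1 := (Finset.single_le_sum (f := fun p => Real.exp (inner ℝ (∑ i, ε i • v i) (θ p)))
      (fun _ _ => (Real.exp_pos _).le) (Finset.mem_univ (S, t))).trans (hle.trans htotal)
    have h2 := Real.exp_le_exp.1 h1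
    have h3 : inner ℝ (∑ i, ε i • v i) (θ (S, t)) =
        lam / (β * κ) * (sgn t * ∑ x : J, DiscAP.incidence F S x * ε x) := by
      simp only [θ, v, inner_smul_right, sum_inner, real_inner_smul_left, Finset.mul_sum]
      refine Finset.sum_congr rfl fun x _ => ?_
      rw [real_inner_comm, hA]
      field_simp
    rw [h3, div_mul_eq_mul_div, div_le_iff₀ (by positivity)] at h2
    refine le_of_mul_le_mul_left (h2.trans (le_of_eq ?_)) hlam0
    ring
  let χ : J → ℤˣ := fun x => if ε x = 1 then 1 else -1
  have hχ : ∀ x, ((χ x : ℤ) : ℝ) = ε x := fun x => by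
    simp only [χ]
    split_ifs with h
    · simp [h]
    · rcases eq_or_eq_neg_of_abs_eq (hε x) with h' | h'
      · exact absurd h' h
      · simp [h']
  refine (Finset.inf'_le _ (Finset.mem_univ χ)).trans (Finset.sup_le fun T hT => ?_)
  obtain ⟨S, hS, rfl⟩ := Finset.mem_image.1 hT
  rw [Nat.le_floor_iff hB, Nat.cast_natAbs, Int.cast_abs]
  have hsum : ((∑ x ∈ S.subtype (· ∈ J), (χ x : ℤ) : ℤ) : ℝ) =
      ∑ x : J, DiscAP.incidence F ⟨S, hS⟩ x * ε x := by
    push_cast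
    simp_rw [hχ, DiscAP.incidence, ite_mul, one_mul, zero_mul]
    rw [← Finset.sum_filter]
    refine Finset.sum_congr ?_ fun _ _ => rfl
    ext x
    simp
  rw [hsum]
  refine abs_le'.2 ⟨?_, ?_⟩
  · simpa [sgn] using hsign ⟨S, hS⟩ true
  · simpa [sgn] using hsign ⟨S, hS⟩ false

/-! ### Product systems and the final estimates. -/

/-- The member `S 0 × ⋯ × S (d - 1)` of the product system. -/
def powerMember {V : Type*} [DecidableEq V] {F : Finset (Finset V)} {d : ℕ} (S : Fin d → F) :
    DiscAP.power F d :=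
  ⟨Fintype.piFinset fun l => (S l).1,
    Finset.mem_image.2 ⟨fun l => (S l).1, Fintype.mem_piFinset.2 fun l => (S l).2, rfl⟩⟩

lemma incidence_powerMember {V : Type*} [DecidableEq V] {F : Finset (Finset V)} {d : ℕ}
    (S : Fin d → F) (x : Fin d → V) :
    DiscAP.incidence (DiscAP.power F d) (powerMember S) x =
      ∏ l, DiscAP.incidence F (S l) (x l) := by
  simp only [DiscAP.incidence, powerMember, Fintype.mem_piFinset]
  rw [Finset.prod_ite_zero]
  simp

lemma powerMember_surjective {V : Type*} [DecidableEq V] {F : Finset (Finset V)} {d : ℕ} :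
    Function.Surjective (powerMember : (Fin d → F) → DiscAP.power F d) := by
  rintro ⟨T, hT⟩
  obtain ⟨S, hS, rfl⟩ := Finset.mem_image.1 hT
  exact ⟨fun l => ⟨S l, Fintype.mem_piFinset.1 hS l⟩, rfl⟩

/-- The product matrix is indexed by tuples of sets; choosing one tuple for each product set selects
the rows needed. -/
lemma HasFactorization.power {V : Type*} [DecidableEq V] {F : Finset (Finset V)} {β κ : ℝ}
    (h : HasFactorization (DiscAP.incidence F) β κ) (hβ : 0 ≤ β) (hκ : 0 ≤ κ) (d : ℕ) :
    HasFactorization (DiscAP.incidence (DiscAP.power F d)) (β ^ d) (κ ^ d) := by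
  have h1 := (h.piPower hβ hκ d).submatrix
    (Function.surjInv (powerMember_surjective (F := F) (d := d)))
  convert h1 using 1
  ext T x
  conv_lhs => rw [← Function.surjInv_eq powerMember_surjective T]
  exact incidence_powerMember _ x

/-- Every factorization of the incidence matrix of `d`-dimensional arithmetic progressions has size
at least `(n ^ (1 / 4) / 64) ^ d`. -/
theorem le_of_hasFactorization_power_AP {n d : ℕ} (hn : 1 ≤ n) {β κ : ℝ} (hβ : 0 ≤ β) (hκ : 0 ≤ κ)
    (h : HasFactorization (DiscAP.incidence (DiscAP.power (DiscAP.AP n) d)) β κ) :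
    ((n : ℝ) ^ (1 / 4 : ℝ) / 64) ^ d ≤ β * κ := by
  set D := Nat.sqrt n with hDdef
  set L := D / 13 + 1 with hLdef
  have hD : 0 < D := Nat.sqrt_pos.2 hn
  have hL : 13 * (L - 1) ≤ D := by omega
  have hLD : L * D ≤ n := (Nat.mul_le_mul_right D (by omega : L ≤ D)).trans (Nat.sqrt_le n)
  obtain ⟨m, _, S, hcard, hlow⟩ := exists_AP_rows (M := L * D) (N := L * D + n + 1)
    hD hL le_rfl (Nat.lt_succ_self _) (n := n)
  have hDr : (0 : ℝ) < D := by exact_mod_cast hD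
  have hnr : (1 : ℝ) ≤ n := by exact_mod_cast hn
  have hLr : (D : ℝ) / 13 ≤ L := by
    rw [div_le_iff₀ (by norm_num)]
    have : D ≤ L * 13 := by omega
    exact_mod_cast this
  have hL0 : (0 : ℝ) < L := by rw [hLdef]; positivity
  set μ : ℝ := (L : ℝ) ^ 2 / 4 with hμdef
  have hμ : 0 < μ := by positivity
  have h1 := (h.submatrix fun i : Fin d → m => powerMember fun l => S (i l)).card_le
    (pow_pos hμ d) fun f => by
      refine (piPower_lower_bound hμ.le hlow d f).trans (le_of_eq ?_)
      refine Finset.sum_congr rfl fun i _ => ?_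
      simp [Matrix.mulVec, dotProduct, incidence_powerMember]
  have hcardr : (Fintype.card m : ℝ) ≤ 3 * n * D := by
    have h2 : Fintype.card m ≤ D * (3 * n) :=
      hcard.trans (Nat.mul_le_mul_left _ (by omega))
    have h3 : (Fintype.card m : ℝ) ≤ D * (3 * n) := by exact_mod_cast h2
    linarith
  rw [Fintype.card_fun, Fintype.card_fun, Fintype.card_fin, Fintype.card_coe, Nat.card_Icc,
    Nat.add_sub_cancel] at h1
  push_cast at h1
  have h2 : (μ * n) ^ d ≤ (3 * n * D) ^ d * (β * κ) ^ 2 := by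
    rw [mul_pow]
    refine h1.trans (mul_le_mul_of_nonneg_right ?_ (sq_nonneg _))
    exact pow_le_pow_left₀ (Nat.cast_nonneg _) hcardr d
  have hsq : ((n : ℝ) ^ (1 / 4 : ℝ)) ^ 2 = √n := by
    rw [Real.sqrt_eq_rpow, ← Real.rpow_natCast, ← Real.rpow_mul (by positivity)]
    norm_num
  have hDn : √(n : ℝ) ≤ 2 * D := by
    have h3 : √(n : ℝ) ≤ D + 1 := Real.real_sqrt_le_nat_sqrt_succ
    have h4 : (1 : ℝ) ≤ D := by exact_mod_cast hD
    linarith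
  -- Here `√n / 64 ^ 2 ≤ D / 2048`, while `μ ≥ D ^ 2 / 676`, and `3 / 2048 ≤ 1 / 676`.
  have hkey : ((n : ℝ) ^ (1 / 4 : ℝ) / 64) ^ 2 * (3 * n * D) ≤ μ * n := by
    have h3 : ((n : ℝ) ^ (1 / 4 : ℝ) / 64) ^ 2 ≤ D / 2048 := by
      rw [div_pow, hsq]; linarith
    have h4 : ((D : ℝ) / 13) ^ 2 ≤ L ^ 2 := pow_le_pow_left₀ (by positivity) hLr 2
    calc _ ≤ (D : ℝ) / 2048 * (3 * n * D) := by gcongr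
      _ = 3 / 2048 * D ^ 2 * n := by ring
      _ ≤ μ * n := by
        refine mul_le_mul_of_nonneg_right ?_ (by linarith)
        rw [hμdef]
        nlinarith [sq_nonneg (D : ℝ)]
  refine abs_le_of_sq_le_sq' ?_ (mul_nonneg hβ hκ) |>.2
  have hpos : (0 : ℝ) < (3 * n * D) ^ d := by positivity
  refine le_of_mul_le_mul_left ?_ hpos
  calc _ = (((n : ℝ) ^ (1 / 4 : ℝ) / 64) ^ 2 * (3 * n * D)) ^ d := by
        rw [pow_right_comm, mul_comm, ← mul_pow]
    _ ≤ (μ * n) ^ d := pow_le_pow_left₀ (by positivity) hkey d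
    _ ≤ _ := h2

theorem proposition7p1 :
    (∃ c C : ℝ, 0 < c ∧ 0 < C ∧ ∀ n : ℕ, 1 ≤ n →
      c * (n : ℝ) ^ (1 / 4 : ℝ) ≤ DiscAP.gamma2System (DiscAP.AP n) ∧
      DiscAP.gamma2System (DiscAP.AP n) ≤ C * (n : ℝ) ^ (1 / 4 : ℝ)) ∧
    (∃ C : ℝ, 0 < C ∧ ∀ n : ℕ, 2 ≤ n →
      (DiscAP.herdisc (DiscAP.AP n) : ℝ) ≤ C * ((n : ℝ) ^ (1 / 4 : ℝ) * √(Real.log n))) ∧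
    (∀ d : ℕ, 1 ≤ d → ∃ c C : ℝ, 0 < c ∧ 0 < C ∧ ∀ n : ℕ, 1 ≤ n →
      c * (n : ℝ) ^ ((d : ℝ) / 4) ≤ DiscAP.gamma2System (DiscAP.power (DiscAP.AP n) d) ∧
      DiscAP.gamma2System (DiscAP.power (DiscAP.AP n) d) ≤ C * (n : ℝ) ^ ((d : ℝ) / 4)) := by
  refine ⟨⟨1 / 64, 18, by norm_num, by norm_num, fun n hn => ⟨?_, ?_⟩⟩,
    ⟨26 * 18 * √7, by positivity, fun n hn => ?_⟩,
    fun d _ => ⟨(1 / 64) ^ d, 18 ^ d, by positivity, by positivity, fun n hn => ⟨?_, ?_⟩⟩⟩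
  · refine le_gamma2 (hasFactorization_AP hn) fun β κ hβ hκ h => ?_
    have := le_of_hasFactorization_power_AP (d := 1) hn (by simpa using hβ) (by simpa using hκ)
      (h.power hβ hκ 1)
    simp only [pow_one] at this
    linarith
  · refine (gamma2_le (by positivity) (by norm_num) (hasFactorization_AP hn)).trans (le_of_eq ?_)
    ring
  · have hn1 : 1 ≤ n := by omega
    have hnr : (2 : ℝ) ≤ n := by exact_mod_cast hn
    refine (herdisc_le_of_hasFactorization (by positivity) (by norm_num) (hasFactorization_AP hn1)
      (Nat.one_le_pow 3 (n + 1) (Nat.succ_pos n)) (card_AP_le n)).trans ?_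
    -- For `n ≥ 2`, `2 * (n + 1) ^ 3 ≤ 16 * n ^ 3 ≤ n ^ 7`.
    have h1 : √(Real.log (2 * ((n + 1) ^ 3 : ℕ))) ≤ √7 * √(Real.log n) := by
      rw [← Real.sqrt_mul (by norm_num)]
      refine Real.sqrt_le_sqrt ?_
      rw [show (7 : ℝ) * Real.log n = Real.log ((n : ℝ) ^ 7) by rw [Real.log_pow]; norm_num]
      refine Real.log_le_log (by positivity) ?_
      push_cast
      calc (2 : ℝ) * ((n : ℝ) + 1) ^ 3 ≤ 2 * (2 * (n : ℝ)) ^ 3 := by gcongr; linarith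
        _ = 2 ^ 4 * (n : ℝ) ^ 3 := by ring
        _ ≤ (n : ℝ) ^ 4 * (n : ℝ) ^ 3 := by gcongr
        _ = (n : ℝ) ^ 7 := by ring
    calc _ ≤ 26 * (6 * (n : ℝ) ^ (1 / 4 : ℝ) * 3) * (√7 * √(Real.log n)) := by gcongr
      _ = _ := by ring
  · refine le_gamma2 ((hasFactorization_AP hn).power (by positivity) (by norm_num) d)
      fun β κ hβ hκ h => ?_
    refine (le_of_eq ?_).trans (le_of_hasFactorization_power_AP hn hβ hκ h)
    rw [div_pow _ _ d, div_pow _ _ d, ← Real.rpow_natCast ((n : ℝ) ^ (1 / 4 : ℝ)), ← Real.rpow_mul (by positivity),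
      one_div_mul_eq_div]
    ring
  · refine (gamma2_le (by positivity) (by positivity)
      ((hasFactorization_AP hn).power (by positivity) (by norm_num) d)).trans (le_of_eq ?_)
    rw [← mul_pow, mul_right_comm, mul_pow, ← Real.rpow_natCast ((n : ℝ) ^ (1 / 4 : ℝ)),
      ← Real.rpow_mul (by positivity), one_div_mul_eq_div]
    norm_num
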